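/- **Theorem 8.5.** Let $d\ge 2$, let $\mathbb S=S^{d-1}$ be the unit sphere of $\mathbb R^d$ with surface measure $dS$, and let $\mathcal H$ be the Herglotz space of all functions $$u(x)=(If)(x)=\frac{\sqrt\pi}{(2\pi)^{d/2}}\int_{\mathbb S} f(\xi)e^{i x\cdot\xi}\,dS(\xi),\qquad f\in L_2(\mathbb S),$$ with the Hilbert space structure for which $I:L_2(\mathbb S)\to\mathcal H$ is unitary. It is a reproducing kernel Hilbert space of functions on $\mathbb R^d$; let $\kappa_x\in\mathcal H$ be its reproducing kernel at $x$, so $u(x)=\langle u,\kappa_x\rangle$. Call a function $\varphi$, positive on $(0,\infty)$, an *admissible radial gauge function* if $\Phi(x)=\varphi(|x|)$ is locally integrable on $\mathbb R^d$ and is a tempered distribution, i.e. $\int_{\mathbb R^d}\varphi(|x|)(1+|x|)^{-N}dx<\infty$ for some $N$, and its Fourier transform (normalized as $\widehat g(\xi)=(2\pi)^{-d/2}\int e^{-ix\cdot\xi}g(x)\,dx$) coincides on the ball $|\xi|<2$, as a distribution, with a function, necessarily radial, $\widehat\Phi(\xi)=\psi(|\xi|)$, that is integrable over the hyperdisk $\{\xi=(0,\xi'):\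 \xi'\in\mathbb R^{d-1},\ |\xi'|\le 2\}$: $$\int_{|\xi'|\le 2}|\widehat\Phi(0,\xi')|\,d\xi'=\int_{|\xi'|\le 2}|\psi(|\xi'|)|\,d\xi'<\infty .$$ Let $\varphi$ be an admissible radial gauge function and let $a:\mathbb R^d\to\mathbb C$ be a locally integrable function such that, for some constants $C,R$, $|a(x)|\le C\varphi(|x|)$ for almost all $x$ with $|x|\ge R$. Then the Toeplitz operator $T_a$ is bounded on $\mathcal H$. That is: the integral $F_a(u,v)=\int_{\mathbb R^d}a(x)u(x)\overline{v(x)}\,dx$ converges absolutely for all $u,v\in\mathcal H$; the sesquilinear form $F_a$ is bounded on $\mathcal H$; and there is a bounded linear operator $T_a$ on $\mathcal H$ with $(T_au)(x)=F_a(u,\kappa_x)$ for all $u\in\mathcal H$, $x\in\mathbb R^d$, and $\langle T_au,v\rangle=F_a(u,v)$ for all $u,v\in\mathcal H$. -/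

import Mathlib

open MeasureTheory Metric
open scoped SchwartzMap ComplexConjugate

noncomputable section

/-- The Euclidean space `ℝᵈ`. -/
abbrev RSpace (d : ℕ) : Type := EuclideanSpace ℝ (Fin d)

/-- The unit sphere `Sᵈ⁻¹` of `ℝᵈ`. -/
abbrev USphere (d : ℕ) : Type := sphere (0 : RSpace d) 1

/-- The Lebesgue surface measure `dS` on the unit sphere. -/
abbrev surfaceMeasure (d : ℕ) : Measure (USphere d) :=
  (volume : Measure (RSpace d)).toSphere

/-- The space `L₂(Sᵈ⁻¹)`. -/
abbrev SphereL2 (d : ℕ) : Type := Lp ℂ 2 (surfaceMeasure d)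

/-- The normalizing constant `c_d = √π / (2π)^{d/2}`. -/
def cNorm (d : ℕ) : ℝ := Real.sqrt Real.pi / (2 * Real.pi) ^ ((d : ℝ) / 2)

/-- The plane wave `e^{i x·ξ}`. -/
def planeWave {d : ℕ} (x ξ : RSpace d) : ℂ := Complex.exp (Complex.I * (inner ℝ x ξ : ℝ))

lemma cNorm_ne_zero (d : ℕ) : cNorm d ≠ 0 := by
  have := Real.pi_pos
  unfold cNorm
  positivity

lemma norm_planeWave {d : ℕ} (x ξ : RSpace d) : ‖planeWave x ξ‖ = 1 := by
  rw [planeWave, mul_comm]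
  exact Complex.norm_exp_ofReal_mul_I _

lemma continuous_planeWave {d : ℕ} :
    Continuous (fun p : RSpace d × RSpace d => planeWave p.1 p.2) := by
  unfold planeWave
  fun_prop

lemma integrable_sphereL2 {d : ℕ} (f : SphereL2 d) : Integrable f (surfaceMeasure d) :=
  (Lp.memLp f).integrable (by norm_num)

lemma integrable_mul_planeWave {d : ℕ} (f : SphereL2 d) (x : RSpace d) :
    Integrable (fun ξ : USphere d => f ξ * planeWave x ξ) (surfaceMeasure d) := by
  refine (integrable_sphereL2 f).mul_bdd (c := 1) ?_ ?_
  · exact (continuous_planeWave.comp (by fun_prop :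
      Continuous fun ξ : USphere d => (x, (ξ : RSpace d)))).aestronglyMeasurable
  · exact Filter.Eventually.of_forall fun ξ => (norm_planeWave _ _).le

/-- The operator `I`, mapping `f ∈ L₂(Sᵈ⁻¹)` to the Herglotz solution
`x ↦ c_d ∫ f(ξ) e^{i x·ξ} dS(ξ)` of the Helmholtz equation. -/
def herglotzOp (d : ℕ) : SphereL2 d →ₗ[ℂ] (RSpace d → ℂ) where
  toFun f := fun x => (cNorm d : ℂ) * ∫ ξ, f ξ * planeWave x ξ ∂(surfaceMeasure d)
  map_add' f g := by
    funext x
    have h : (∫ ξ, (f + g : SphereL2 d) ξ * planeWave x ξ ∂(surfaceMeasure d))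
        = ∫ ξ, (f ξ * planeWave x ξ + g ξ * planeWave x ξ) ∂(surfaceMeasure d) := by
      refine integral_congr_ae ?_
      filter_upwards [Lp.coeFn_add f g] with ξ hξ
      rw [hξ, Pi.add_apply, add_mul]
    simp only [Pi.add_apply]
    rw [h, integral_add (integrable_mul_planeWave f x) (integrable_mul_planeWave g x), mul_add]
  map_smul' c f := by
    funext x
    have h : (∫ ξ, (c • f : SphereL2 d) ξ * planeWave x ξ ∂(surfaceMeasure d))
        = ∫ ξ, c * (f ξ * planeWave x ξ) ∂(surfaceMeasure d) := by
      refine integral_congr_ae ?_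
      filter_upwards [Lp.coeFn_smul c f] with ξ hξ
      simp [hξ, mul_assoc]
    simp only [RingHom.id_apply, Pi.smul_apply, smul_eq_mul]
    rw [h, integral_const_mul]
    ring

lemma herglotzOp_apply {d : ℕ} (f : SphereL2 d) (x : RSpace d) :
    herglotzOp d f x = (cNorm d : ℂ) * ∫ ξ, f ξ * planeWave x ξ ∂(surfaceMeasure d) := rfl

/-- A square integrable density on the sphere is determined by its Herglotz solution. -/
lemma herglotzOp_injective (d : ℕ) : Function.Injective (herglotzOp d) := by
  rw [← LinearMap.ker_eq_bot, LinearMap.ker_eq_bot']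
  intro f hf
  have h0 : ∀ x : RSpace d, ∫ ξ, f ξ * planeWave x ξ ∂(surfaceMeasure d) = 0 := by
    intro x
    have h1 := congrFun hf x
    rw [herglotzOp_apply] at h1
    simpa [cNorm_ne_zero] using h1
  -- the density is orthogonal to the restriction of every Schwartz function
  have hS : ∀ g : 𝓢(RSpace d, ℂ),
      ∫ ξ : USphere d, g (ξ : RSpace d) * f ξ ∂(surfaceMeasure d) = 0 := by
    intro g
    obtain ⟨h, rfl⟩ : ∃ h : 𝓢(RSpace d, ℂ), FourierTransform.fourier h = g :=
      ⟨FourierTransformInv.fourierInv g, FourierTransform.fourier_fourierInv_eq g⟩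
    have e1 : ∀ ξ : RSpace d, (FourierTransform.fourier h) ξ
        = ∫ x, planeWave ((-(2 * Real.pi)) • x) ξ * h x := by
      intro ξ
      rw [SchwartzMap.fourier_coe, Real.fourier_eq']
      refine integral_congr_ae (Filter.Eventually.of_forall fun x => ?_)
      simp only [planeWave, inner_smul_left, smul_eq_mul]
      congr 2
      push_cast
      simp
      ring
    have hint : Integrable (fun p : USphere d × RSpace d =>
        (planeWave ((-(2 * Real.pi)) • p.2) (p.1 : RSpace d) * h p.2) * f p.1)
        ((surfaceMeasure d).prod volume) := by
      have h1 := ((integrable_sphereL2 f).mul_prod (h.integrable (μ := volume))).bdd_mul (c := 1)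
        (f := fun p : USphere d × RSpace d =>
          planeWave ((-(2 * Real.pi)) • p.2) (p.1 : RSpace d))
        ((continuous_planeWave.comp (by fun_prop : Continuous
          fun p : USphere d × RSpace d =>
            ((-(2 * Real.pi)) • p.2, (p.1 : RSpace d)))).aestronglyMeasurable)
        (Filter.Eventually.of_forall fun p => (norm_planeWave _ _).le)
      refine h1.congr (Filter.Eventually.of_forall fun p => ?_)
      simp only
      ring
    calc ∫ ξ : USphere d, (FourierTransform.fourier h) (ξ : RSpace d) * f ξ ∂(surfaceMeasure d)
        = ∫ ξ : USphere d, (∫ x : RSpace d,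
            (planeWave ((-(2 * Real.pi)) • x) (ξ : RSpace d) * h x) * f ξ)
              ∂(surfaceMeasure d) := by
          refine integral_congr_ae (Filter.Eventually.of_forall fun ξ => ?_)
          simp only
          rw [e1, ← integral_mul_const]
      _ = ∫ x : RSpace d, ∫ ξ : USphere d,
            (planeWave ((-(2 * Real.pi)) • x) (ξ : RSpace d) * h x) * f ξ
              ∂(surfaceMeasure d) := integral_integral_swap hint
      _ = ∫ x : RSpace d, h x * ∫ ξ : USphere d,
            f ξ * planeWave ((-(2 * Real.pi)) • x) (ξ : RSpace d) ∂(surfaceMeasure d) := by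
          refine integral_congr_ae (Filter.Eventually.of_forall fun x => ?_)
          simp only
          rw [← integral_const_mul]
          refine integral_congr_ae (Filter.Eventually.of_forall fun ξ => ?_)
          simp only
          ring
      _ = 0 := by simp [h0]
  have hemb : MeasurableEmbedding (Subtype.val : USphere d → RSpace d) :=
    MeasurableEmbedding.subtype_coe isClosed_sphere.measurableSet
  set F : RSpace d → ℂ := Function.extend Subtype.val f 0 with hF
  have hFs : ∀ ξ : USphere d, F ξ = f ξ := fun ξ => hemb.injective.extend_apply _ _ _
  have hFi : Integrable F ((surfaceMeasure d).map Subtype.val) := by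
    rw [hemb.integrable_map_iff]
    exact (integrable_sphereL2 f).congr (Filter.Eventually.of_forall fun ξ => (hFs ξ).symm)
  have hz := ae_eq_zero_of_integral_contDiff_smul_eq_zero hFi.locallyIntegrable (by
    intro g hg hgc
    have hg₁ : HasCompactSupport (Complex.ofRealCLM ∘ g) := hgc.comp_left rfl
    have hg₂ : ContDiff ℝ (⊤ : ℕ∞) (Complex.ofRealCLM ∘ g) := by fun_prop
    rw [hemb.integral_map]
    have := hS (hg₁.toSchwartzMap hg₂)
    simpa [hFs] using this)
  rw [hemb.ae_map_iff] at hz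
  rw [Lp.eq_zero_iff_ae_eq_zero]
  filter_upwards [hz] with ξ hξ
  simpa [hFs] using hξ

/-- The Herglotz space `ℋ`: all functions on `ℝᵈ` of the form `I f` with `f ∈ L₂(Sᵈ⁻¹)`. -/
def Herglotz (d : ℕ) : Type := ↥(LinearMap.range (herglotzOp d))

namespace Herglotz

variable {d : ℕ}

instance : AddCommGroup (Herglotz d) :=
  inferInstanceAs (AddCommGroup ↥(LinearMap.range (herglotzOp d)))

instance : Module ℂ (Herglotz d) :=
  inferInstanceAs (Module ℂ ↥(LinearMap.range (herglotzOp d)))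

/-- The operator `I` as a linear bijection of `L₂(Sᵈ⁻¹)` onto `ℋ`. -/
def ofDensity (d : ℕ) : SphereL2 d ≃ₗ[ℂ] Herglotz d :=
  LinearEquiv.ofInjective (herglotzOp d) (herglotzOp_injective d)

/-- The density `f ∈ L₂(Sᵈ⁻¹)` of `u = I f`. -/
def density (d : ℕ) : Herglotz d ≃ₗ[ℂ] SphereL2 d := (ofDensity d).symm

/-- The norm of `ℋ`, for which `I` is isometric. -/
instance : NormedAddCommGroup (Herglotz d) :=
  NormedAddCommGroup.induced (Herglotz d) (SphereL2 d) (density d) (density d).injective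

lemma norm_def (u : Herglotz d) : ‖u‖ = ‖density d u‖ := rfl

/-- The scalar product of `ℋ`, for which `I` is unitary. -/
instance : InnerProductSpace ℂ (Herglotz d) where
  norm_smul_le c u := by simp only [norm_def, map_smul, norm_smul, le_refl]
  inner u v := inner ℂ (density d u) (density d v)
  norm_sq_eq_re_inner u := norm_sq_eq_re_inner (density d u)
  conj_inner_symm u v := inner_conj_symm _ _
  add_left u v w := by simp only [map_add, inner_add_left]
  smul_left u v c := by simp only [map_smul, inner_smul_left]

/-- The isometry of `ℋ` onto `L₂(Sᵈ⁻¹)` which is inverse to `I`. -/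
def densityIsometry (d : ℕ) : Herglotz d ≃ₗᵢ[ℂ] SphereL2 d :=
  ⟨density d, fun _ => rfl⟩

instance : CompleteSpace (Herglotz d) :=
  (densityIsometry d).toIsometryEquiv.completeSpace_iff.2 inferInstance

/-- An element of `ℋ`, viewed as a function on `ℝᵈ`. -/
def toFunLinear (d : ℕ) : Herglotz d →ₗ[ℂ] (RSpace d → ℂ) :=
  (LinearMap.range (herglotzOp d)).subtype

lemma toFunLinear_eq (u : Herglotz d) : toFunLinear d u = herglotzOp d (density d u) := by
  obtain ⟨f, rfl⟩ := (ofDensity d).surjective u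
  simp only [density, LinearEquiv.symm_apply_apply]
  rfl

lemma continuous_toFunLinear (d : ℕ) : Continuous (toFunLinear d) := by
  refine continuous_pi fun x => ?_
  have hL1 : Continuous fun f : SphereL2 d => herglotzOp d f x := by
    have hm : MemLp (fun ξ : USphere d => conj (planeWave x ξ)) 2 (surfaceMeasure d) := by
      refine MemLp.of_bound (C := 1) ?_ ?_
      · exact (Complex.continuous_conj.comp (continuous_planeWave.comp (by fun_prop :
          Continuous fun ξ : USphere d => (x, (ξ : RSpace d))))).aestronglyMeasurable
      · exact Filter.Eventually.of_forall fun ξ => by simp [norm_planeWave]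
    have he : ∀ f : SphereL2 d,
        herglotzOp d f x = (cNorm d : ℂ) * inner ℂ (hm.toLp _) f := by
      intro f
      rw [herglotzOp_apply, L2.inner_def]
      congr 1
      refine integral_congr_ae ?_
      filter_upwards [hm.coeFn_toLp] with ξ hξ
      simp [hξ]
    simp only [he]
    fun_prop
  have : (fun u => toFunLinear d u x)
      = (fun f : SphereL2 d => herglotzOp d f x) ∘ densityIsometry d := by
    funext u
    simp only [toFunLinear_eq]
    rfl
  rw [this]
  exact hL1.comp (densityIsometry d).continuous

/-- `ℋ` is a reproducing kernel Hilbert space of functions on `ℝᵈ`. -/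
instance : RKHS ℂ (Herglotz d) (RSpace d) ℂ where
  coeCLM := ⟨toFunLinear d, continuous_toFunLinear d⟩
  coeCLM_injective := Subtype.val_injective

lemma coe_eq (u : Herglotz d) : ⇑u = herglotzOp d (density d u) := toFunLinear_eq u

/-- The reproducing kernel `κ_x ∈ ℋ` at the point `x`, so that `u(x) = ⟨u, κ_x⟩`. -/
def reproducingKernel (x : RSpace d) : Herglotz d := RKHS.kerFun (Herglotz d) x 1

end Herglotz

/-- The sesquilinear form `F_a(u, v) = ∫ a(x) u(x) conj(v(x)) dx`. -/
def symbolForm {d : ℕ} (a : RSpace d → ℂ) (u v : Herglotz d) : ℂ :=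
  ∫ x, a x * u x * conj (v x)

/-- `F_a` is defined on all of `ℋ`, by an absolutely convergent integral, and bounded there. -/
def IsBoundedSymbolForm {d : ℕ} (a : RSpace d → ℂ) : Prop :=
  (∀ u v : Herglotz d, Integrable (fun x => a x * u x * conj (v x))) ∧
    ∃ K : ℝ, ∀ u v : Herglotz d, ‖symbolForm a u v‖ ≤ K * ‖u‖ * ‖v‖

/-- The bounded operator `T` is the Toeplitz operator with symbol `a`:
`(T u)(x) = F_a(u, κ_x)`. -/
def IsToeplitzOperator {d : ℕ} (a : RSpace d → ℂ) (T : Herglotz d →L[ℂ] Herglotz d) : Prop :=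
  ∀ (u : Herglotz d) (x : RSpace d), T u x = symbolForm a u (Herglotz.reproducingKernel x)

/-- The Fourier transform `(2π)^{-d/2} ∫ e^{-i x·ξ} f(ξ) dξ` of a function on `ℝᵈ`. -/
def unitaryFourier {d : ℕ} (f : RSpace d → ℂ) (x : RSpace d) : ℂ :=
  ((2 * Real.pi) ^ (-(d : ℝ) / 2) : ℝ) * ∫ ξ, planeWave (-x) ξ * f ξ

/-- Admissible radial gauge functions on `ℝᵈ`. The Fourier transform of `x ↦ φ(|x|)` is the one of
tempered distributions. It is rotation invariant, so being a function on the ball `|ξ| < 2` it has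
the form `ψ(|ξ|)` there, and its restriction to the hyperplane `ξ₁ = 0` is `ξ' ↦ ψ(|ξ'|)`,
`ξ' ∈ ℝᵈ⁻¹`. -/
structure IsAdmissibleRadialGauge (d : ℕ) (φ : ℝ → ℝ) : Prop where
  pos : ∀ t, 0 < t → 0 < φ t
  locallyIntegrable : LocallyIntegrable (fun x : RSpace d => φ ‖x‖)
  /-- `x ↦ φ(|x|)` is a tempered distribution, so that it has a Fourier transform. -/
  tempered : ∃ N : ℕ, Integrable (fun x : RSpace d => φ ‖x‖ / (1 + ‖x‖) ^ N)
  /-- The Fourier transform is a function on the ball `|ξ| < 2`, integrable over the hyperdisk. -/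
  fourier : ∃ ψ : ℝ → ℂ,
    (∀ f : 𝓢(RSpace d, ℂ), tsupport f ⊆ ball (0 : RSpace d) 2 →
      ∫ x : RSpace d, (φ ‖x‖ : ℂ) * unitaryFourier f x = ∫ ξ : RSpace d, ψ ‖ξ‖ * f ξ) ∧
    IntegrableOn (fun ξ' : RSpace (d - 1) => ψ ‖ξ'‖) (closedBall 0 2)

end

/-! Everything rests on the Carleson estimate `∫ φ(|x|) |u(x)|² dx ≤ C ‖u‖²` for `u ∈ ℋ`
(`IsAdmissibleRadialGauge.exists_lintegral_herglotz_le`). Point evaluations on `ℋ` are bounded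
uniformly in the point, so the ball `|x| ≤ R` costs only the integral of `|a|` over it, while
outside it `|a|` is controlled by `φ`. Hence `|a| dx` is a Carleson measure as well, `F_a` converges
absolutely and is bounded, and the Riesz representation yields `T_a`.

For the estimate, `u` is the Fourier transform of a measure on the sphere. Thicken its density `f`
to a function `G` on a shell of thickness `ε` and height about `1/ε`. Up to a constant, `|Ĝ|²` is
the Fourier transform of the autocorrelation of `G`. Testing the hypothesis on `φ` with this
autocorrelation turns `∫ φ |Ĝ|²` into an integral against `ψ(|ζ|)`, which is dominated by the
quadratic form of the kernel `|ψ(|ξ - η|)|` on `|G|`.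

Schur's test bounds this form. A sphere of radius `r` around a point of the shell meets the shell in
a strip of angular width about `ε / r`, so the weight `r ^ (d - 1)` of polar coordinates improves to
`ε r ^ (d - 2)`, which is the weight of the hyperdisk (`exists_lintegral_shellCap_le`). The form is
thus `O(ε ‖G‖²)`, and `‖G‖² = O(‖f‖² / ε)`. The powers of `ε` cancel, and Fatou's lemma lets `ε →
0`.

The argument is run on small caps. Differences of points then stay well inside the ball `|ξ| < 2`
where `ψ` is available, and the strips avoid the poles, where their measure need not be proportional
to their width. Finitely many caps cover the sphere. -/

noncomputable section

open scoped ENNReal Pointwise Convolution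
open Set Filter Topology

/-! ### Polar coordinates -/

/-- Polar coordinates, for nonnegative functions. -/
lemma lintegral_eq_lintegral_prod {d : ℕ} (hd : 1 ≤ d) {H : RSpace d → ℝ≥0∞}
    (hH : Measurable H) :
    ∫⁻ x, H x = ∫⁻ q : USphere d × Ioi (0 : ℝ), H ((q.2 : ℝ) • (q.1 : RSpace d))
      ∂((surfaceMeasure d).prod (Measure.volumeIoiPow (d - 1))) := by
  have : Nonempty (Fin d) := ⟨⟨0, hd⟩⟩
  have hmp := (volume : Measure (RSpace d)).measurePreserving_homeomorphUnitSphereProd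
  rw [finrank_euclideanSpace_fin] at hmp
  have h1 : ∫⁻ x, H x = ∫⁻ x : ({(0 : RSpace d)}ᶜ : Set (RSpace d)), H x
      ∂((volume : Measure (RSpace d)).comap (↑)) := by
    rw [lintegral_subtype_comap (measurableSet_singleton _).compl, restrict_compl_singleton]
  rw [h1, ← hmp.lintegral_comp (f := fun q : USphere d × Ioi (0 : ℝ) =>
    H ((q.2 : ℝ) • (q.1 : RSpace d))) (hH.comp (by fun_prop))]
  refine lintegral_congr fun x => ?_
  have hx : (x : RSpace d) ≠ 0 := x.2
  simp [smul_smul, hx]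

/-- Polar coordinates. -/
lemma integral_eq_integral_prod {d : ℕ} (hd : 1 ≤ d) (H : RSpace d → ℂ) :
    ∫ x, H x = ∫ q : USphere d × Ioi (0 : ℝ), H ((q.2 : ℝ) • (q.1 : RSpace d))
      ∂((surfaceMeasure d).prod (Measure.volumeIoiPow (d - 1))) := by
  have : Nonempty (Fin d) := ⟨⟨0, hd⟩⟩
  have hmp := (volume : Measure (RSpace d)).measurePreserving_homeomorphUnitSphereProd
  rw [finrank_euclideanSpace_fin] at hmp
  have h1 : ∫ x, H x = ∫ x : ({(0 : RSpace d)}ᶜ : Set (RSpace d)), H x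
      ∂((volume : Measure (RSpace d)).comap (↑)) := by
    rw [integral_subtype_comap (measurableSet_singleton _).compl, restrict_compl_singleton]
  rw [h1, ← hmp.integral_comp (homeomorphUnitSphereProd (RSpace d)).measurableEmbedding
    (fun q : USphere d × Ioi (0 : ℝ) => H ((q.2 : ℝ) • (q.1 : RSpace d)))]
  refine integral_congr_ae (.of_forall fun x => ?_)
  have hx : (x : RSpace d) ≠ 0 := x.2
  simp [smul_smul, hx]

/-- Iterated integration in polar coordinates. -/
lemma lintegral_polar {d : ℕ} (hd : 1 ≤ d) {H : RSpace d → ℝ≥0∞} (hH : Measurable H) :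
    ∫⁻ x, H x = ∫⁻ r in Ioi (0 : ℝ), ENNReal.ofReal (r ^ (d - 1)) *
      ∫⁻ ω : USphere d, H (r • (ω : RSpace d)) ∂(surfaceMeasure d) := by
  have hm : Measurable (fun q : USphere d × Ioi (0 : ℝ) => H ((q.2 : ℝ) • (q.1 : RSpace d))) :=
    hH.comp (by fun_prop)
  rw [lintegral_eq_lintegral_prod hd hH, lintegral_prod_symm' _ hm, Measure.volumeIoiPow,
    lintegral_withDensity_eq_lintegral_mul _ (by fun_prop) hm.lintegral_prod_left',
    ← lintegral_subtype_comap measurableSet_Ioi]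
  simp

/-! ### Thin slabs of the sphere -/

/-- A line in direction `e` meets a truncated conical slab around a hyperplane transversal to `e`
in a set whose diameter is controlled by the thickness of the slab. -/
lemma abs_le_of_mem_slab {E : Type*} [NormedAddCommGroup E] [InnerProductSpace ℝ E] {e x y : E}
    {s h t : ℝ} (he : 1 / 2 ≤ ‖e‖ ^ 2) (hxy : x - y = t • e) (hy1 : ‖y‖ < 1)
    (hx0 : 0 < ‖x‖) (hy0 : 0 < ‖y‖)
    (hx2 : |inner ℝ x e| ≤ ‖x‖ / 2) (hy2 : |inner ℝ y e| ≤ ‖y‖ / 2)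
    (hx3 : |inner ℝ x e - s * ‖x‖| ≤ h * ‖x‖) (hy3 : |inner ℝ y e - s * ‖y‖| ≤ h * ‖y‖) :
    |t| ≤ 8 * h := by
  have e1 : inner ℝ x e - inner ℝ y e = t * ‖e‖ ^ 2 := by
    rw [← inner_sub_left, hxy, inner_smul_left, real_inner_self_eq_norm_sq]; simp
  have e2 : ‖x‖ ^ 2 - ‖y‖ ^ 2 = t * (inner ℝ x e + inner ℝ y e) := by
    have : x = y + t • e := by rw [← hxy]; abel
    have h3 : ‖x‖ ^ 2 = ‖y‖ ^ 2 + 2 * (t * inner ℝ y e) + t ^ 2 * ‖e‖ ^ 2 := by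
      rw [this, norm_add_sq_real, inner_smul_right, norm_smul, mul_pow, Real.norm_eq_abs, sq_abs]
    have : inner ℝ x e = inner ℝ y e + t * ‖e‖ ^ 2 := by linarith
    rw [h3, this]; ring
  set a : ℝ := inner ℝ x e
  set b : ℝ := inner ℝ y e
  have h0 : 0 ≤ h := by
    by_contra hh
    have : h * ‖x‖ < 0 := by nlinarith
    linarith [abs_nonneg (a - s * ‖x‖)]
  -- the norms vary slowly along the line
  have e3 : |‖x‖ - ‖y‖| ≤ |t| / 2 := by
    have h4 : |‖x‖ - ‖y‖| * (‖x‖ + ‖y‖) = |t| * |a + b| := by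
      have : |‖x‖ - ‖y‖| * |‖x‖ + ‖y‖| = |t| * |a + b| := by
        rw [← abs_mul, ← abs_mul, ← e2]
        congr 1; ring
      rwa [abs_of_pos (add_pos hx0 hy0)] at this
    have h5 : |a + b| ≤ (‖x‖ + ‖y‖) / 2 := (abs_add_le a b).trans (by linarith)
    have h6 : |t| * |a + b| ≤ |t| * ((‖x‖ + ‖y‖) / 2) := by gcongr
    have h7 : 0 < ‖x‖ + ‖y‖ := by positivity
    have h8 : |‖x‖ - ‖y‖| * (‖x‖ + ‖y‖) ≤ (|t| / 2) * (‖x‖ + ‖y‖) := by linarith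
    exact le_of_mul_le_mul_right h8 h7
  have e4 : |a / ‖x‖| ≤ 1 / 2 := by
    rw [abs_div, abs_of_pos hx0, div_le_iff₀ hx0]; linarith
  have e5 : |a / ‖x‖ - s| ≤ h := by
    have : a / ‖x‖ - s = (a - s * ‖x‖) / ‖x‖ := by field_simp
    rw [this, abs_div, abs_of_pos hx0, div_le_iff₀ hx0]; exact hx3
  have e6 : |b / ‖y‖ - s| ≤ h := by
    have : b / ‖y‖ - s = (b - s * ‖y‖) / ‖y‖ := by field_simp
    rw [this, abs_div, abs_of_pos hy0, div_le_iff₀ hy0]; exact hy3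
  -- With `α = a / ‖x‖` and `β = b / ‖y‖` this is the product rule for `α ‖x‖ - β ‖y‖`. Its terms
  -- are at most `|t| / 4` and `2 h`. Since `‖e‖ ^ 2 ≥ 1 / 2`, there remains `|t| / 4 ≤ 2 h`, whence
  -- the constant `8`.
  have e7 : t * ‖e‖ ^ 2 = a / ‖x‖ * (‖x‖ - ‖y‖) + ((a / ‖x‖ - s) - (b / ‖y‖ - s)) * ‖y‖ := by
    rw [← e1]; field_simp; ring
  have e8 : |t| * ‖e‖ ^ 2 ≤ |t| / 4 + 2 * h := by
    rw [← abs_of_nonneg (sq_nonneg ‖e‖), ← abs_mul, e7]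
    refine (abs_add_le _ _).trans (add_le_add ?_ ?_)
    · rw [abs_mul]
      calc _ ≤ 1 / 2 * (|t| / 2) := by gcongr
        _ = _ := by ring
    · rw [abs_mul, abs_of_pos hy0]
      calc _ ≤ (h + h) * 1 := by
            gcongr
            exact (abs_sub _ _).trans (add_le_add e5 e6)
        _ = _ := by ring
  nlinarith [abs_nonneg t, mul_le_mul_of_nonneg_left he (abs_nonneg t)]

/-- The volume of a truncated conical slab is at most proportional to its thickness. -/
lemma volume_slab_le {d : ℕ} {e : RSpace d} (he : 1 / 2 ≤ ‖e‖ ^ 2) (he2 : ‖e‖ ≤ 2) (s h : ℝ) :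
    volume {x : RSpace d | 0 < ‖x‖ ∧ ‖x‖ < 1 ∧ |inner ℝ x e| ≤ ‖x‖ / 2 ∧
      |inner ℝ x e - s * ‖x‖| ≤ h * ‖x‖} ≤
      ENNReal.ofReal (8 * h) * volume (ball (0 : RSpace d) 3) := by
  set B := {x : RSpace d | 0 < ‖x‖ ∧ ‖x‖ < 1 ∧ |inner ℝ x e| ≤ ‖x‖ / 2 ∧
      |inner ℝ x e - s * ‖x‖| ≤ h * ‖x‖} with hB
  have hBm : MeasurableSet B := by
    simp only [hB, Set.ofPred_and]
    refine ((measurableSet_lt (by fun_prop) (by fun_prop)).inter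
      ((measurableSet_lt (by fun_prop) (by fun_prop)).inter
      ((measurableSet_le (by fun_prop) (by fun_prop)).inter
      (measurableSet_le (by fun_prop) (by fun_prop)))))
  have hm : Measurable (fun q : ℝ × RSpace d => B.indicator (1 : RSpace d → ℝ≥0∞)
      (q.2 - q.1 • e)) :=
    (measurable_const.indicator hBm).comp (by fun_prop)
  -- Average the volume over the translates `B + t • e`, `0 ≤ t ≤ 1`, and exchange the integrals.
  -- What remains is the length of `{t | x - t • e ∈ B}`, a set of diameter at most `8 h` which
  -- misses `[0, 1]` unless `‖x‖ < 1 + 2`.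
  calc volume B = ∫⁻ t in Icc (0 : ℝ) 1, volume B := by simp
    _ = ∫⁻ t in Icc (0 : ℝ) 1, ∫⁻ x, B.indicator (1 : RSpace d → ℝ≥0∞) (x - t • e) := by
        refine lintegral_congr fun t => ?_
        rw [lintegral_sub_right_eq_self (fun x => B.indicator (1 : RSpace d → ℝ≥0∞) x),
          lintegral_indicator_one hBm]
    _ = ∫⁻ x, ∫⁻ t in Icc (0 : ℝ) 1, B.indicator (1 : RSpace d → ℝ≥0∞) (x - t • e) :=
        lintegral_lintegral_swap hm.aemeasurable
    _ ≤ ∫⁻ x, (ball (0 : RSpace d) 3).indicator (fun _ => ENNReal.ofReal (8 * h)) x := by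
        refine lintegral_mono fun x => ?_
        by_cases hx : x ∈ ball (0 : RSpace d) 3
        · rw [indicator_of_mem hx]
          have hms : MeasurableSet {t : ℝ | x - t • e ∈ B} :=
            hBm.preimage (by fun_prop : Measurable fun t : ℝ => x - t • e)
          calc _ ≤ ∫⁻ t, {t : ℝ | x - t • e ∈ B}.indicator (1 : ℝ → ℝ≥0∞) t :=
                setLIntegral_le_lintegral _ _
            _ = volume {t : ℝ | x - t • e ∈ B} := lintegral_indicator_one hms
            _ ≤ ediam {t : ℝ | x - t • e ∈ B} := Real.volume_le_diam _
            _ ≤ _ := by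
              refine ediam_le fun t ht t' ht' => ?_
              rw [edist_dist, Real.dist_eq]
              refine ENNReal.ofReal_le_ofReal ?_
              obtain ⟨a1, a2, a3, a4⟩ := ht
              obtain ⟨b1, b2, b3, b4⟩ := ht'
              rw [abs_sub_comm]
              exact abs_le_of_mem_slab he (by module) b2 a1 b1 a3 b3 a4 b4
        · rw [indicator_of_notMem hx]
          refine (setLIntegral_eq_zero measurableSet_Icc fun t ht => ?_).le
          refine indicator_of_notMem (fun hmem => hx ?_) _
          have h1 : ‖x‖ ≤ ‖x - t • e‖ + ‖t • e‖ := by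
            simpa using norm_add_le (x - t • e) (t • e)
          have h2 : ‖t • e‖ ≤ 1 * 2 := by
            rw [norm_smul, Real.norm_eq_abs, abs_of_nonneg ht.1]
            exact mul_le_mul ht.2 he2 (norm_nonneg _) zero_le_one
          rw [mem_ball_zero_iff]
          linarith [hmem.2.1]
    _ = _ := by rw [lintegral_indicator_const measurableSet_ball]

/-- The surface measure of a slab of the sphere which stays away from the poles is at most
proportional to its thickness. -/
lemma surfaceMeasure_slab_le {d : ℕ} {e : RSpace d} (he : 1 / 2 ≤ ‖e‖ ^ 2) (he2 : ‖e‖ ≤ 2)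
    (s h : ℝ) :
    surfaceMeasure d {ω | |inner ℝ (ω : RSpace d) e| ≤ 1 / 2 ∧ |inner ℝ (ω : RSpace d) e - s| ≤ h}
      ≤ d * (ENNReal.ofReal (8 * h) * volume (ball (0 : RSpace d) 3)) := by
  -- The surface measure of a set is `d` times the volume of the truncated cone over it.
  rw [surfaceMeasure, Measure.toSphere_apply', finrank_euclideanSpace_fin]
  · gcongr
    refine (measure_mono ?_).trans (volume_slab_le he he2 s h)
    rintro _ ⟨r, ⟨hr0, hr1⟩, _, ⟨ω, ⟨h1, h2⟩, rfl⟩, rfl⟩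
    have hn : ‖r • (ω : RSpace d)‖ = r := by
      rw [norm_smul, norm_eq_of_mem_sphere ω, Real.norm_eq_abs, abs_of_pos hr0, mul_one]
    simp only [mem_ofPred_eq, hn, inner_smul_left]
    refine ⟨hr0, hr1, ?_, ?_⟩
    · simp only [conj_trivial, abs_mul, abs_of_pos hr0]
      nlinarith
    · have : (conj r) * inner ℝ (ω : RSpace d) e - s * r
          = r * (inner ℝ (ω : RSpace d) e - s) := by
        simp only [conj_trivial]; ring
      rw [this, abs_mul, abs_of_pos hr0]
      nlinarith
  · simp only [Set.ofPred_and]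
    exact (measurableSet_le (by fun_prop) (by fun_prop)).inter
      (measurableSet_le (by fun_prop) (by fun_prop))

/-! ### Spheres centred in a thin cap -/

/-- The part near `p` of the spherical shell of thickness `4 ε`. -/
def shellCap {d : ℕ} (p : RSpace d) (ε : ℝ) : Set (RSpace d) :=
  {ζ | |‖ζ‖ - 1| < 2 * ε ∧ dist ζ p < 1 / 4}

lemma isOpen_shellCap {d : ℕ} (p : RSpace d) (ε : ℝ) : IsOpen (shellCap p ε) := by
  simp only [shellCap, Set.ofPred_and]
  exact (isOpen_lt (by fun_prop) (by fun_prop)).inter (isOpen_lt (by fun_prop) (by fun_prop))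

/-- The diameter bound serves twice: it limits the radii that matter in the strip estimate, and it
keeps autocorrelations supported well inside `|ζ| < 2`. -/
lemma dist_lt_of_mem_shellCap {d : ℕ} {p ξ η : RSpace d} {ε : ℝ} (hξ : ξ ∈ shellCap p ε)
    (hη : η ∈ shellCap p ε) : dist ξ η < 1 / 2 := by
  have := dist_triangle_right ξ η p
  linarith [hξ.2, hη.2]

/-- The sphere of radius `r` around a point of a thin cap meets this cap in a small set. -/
lemma exists_surfaceMeasure_shellCap_le (d : ℕ) : ∃ C : ℝ≥0∞, C ≠ ∞ ∧
    ∀ (p : RSpace d) (ε : ℝ), 0 < ε → ε ≤ 1 / 20 → ∀ ξ ∈ shellCap p ε, ∀ r : ℝ, 0 < r →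
      ENNReal.ofReal r * surfaceMeasure d {ω | ξ + r • (ω : RSpace d) ∈ shellCap p ε} ≤
        C * ENNReal.ofReal ε := by
  refine ⟨20 * surfaceMeasure d univ + d * (20 * volume (ball (0 : RSpace d) 3)), ?_, ?_⟩
  · have h1 := measure_ne_top (surfaceMeasure d) univ
    have h2 := (measure_ball_lt_top (μ := volume) (x := (0 : RSpace d)) (r := 3)).ne
    finiteness
  intro p ε hε hε2 ξ hξ r hr
  rw [add_mul]
  -- For `r ≤ 20 ε` the total area suffices. For larger `r`, expanding `‖ξ + r ω‖²`, which is within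
  -- `5 ε` of `1`, confines `⟨ω, ξ⟩` to an interval of half-width `5 ε / (2 r)`. Moreover `|⟨ω, ξ⟩|
  -- ≤ 5 ε / r + r / 2 ≤ 1 / 4 + 1 / 4`, by the threshold `20 ε` and by `r < 1 / 2`.
  rcases le_or_gt r (20 * ε) with hle | hgt
  · refine le_trans ?_ le_self_add
    calc _ ≤ ENNReal.ofReal (20 * ε) * surfaceMeasure d univ := by gcongr; exact subset_univ _
      _ = _ := by
        rw [ENNReal.ofReal_mul (by norm_num)]
        simp only [ENNReal.ofReal_ofNat]; ring
  · refine le_trans ?_ le_add_self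
    have hξ1 := abs_lt.1 hξ.1
    have hsub : {ω : USphere d | ξ + r • (ω : RSpace d) ∈ shellCap p ε} ⊆
        {ω | |inner ℝ (ω : RSpace d) ξ| ≤ 1 / 2 ∧
          |inner ℝ (ω : RSpace d) ξ - (1 - ‖ξ‖ ^ 2 - r ^ 2) / (2 * r)| ≤ 5 * ε / (2 * r)} := by
      intro ω hω
      have hn : ‖(ω : RSpace d)‖ = 1 := norm_eq_of_mem_sphere ω
      have hr2 : r < 1 / 2 := by
        have := dist_lt_of_mem_shellCap hω hξ
        rwa [dist_eq_norm, add_sub_cancel_left, norm_smul, hn, mul_one, Real.norm_eq_abs,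
          abs_of_pos hr] at this
      have hη1 := abs_lt.1 hω.1
      have e1 : ‖ξ + r • (ω : RSpace d)‖ ^ 2 =
          ‖ξ‖ ^ 2 + 2 * (r * inner ℝ (ω : RSpace d) ξ) + r ^ 2 := by
        rw [norm_add_sq_real, inner_smul_right, real_inner_comm, norm_smul, hn, mul_one,
          Real.norm_eq_abs, sq_abs]
      have sqb : ∀ n : ℝ, -(2 * ε) < n - 1 → n - 1 < 2 * ε → |n ^ 2 - 1| ≤ 5 * ε := by
        intro n h1 h2
        rw [abs_le]
        constructor <;> nlinarith
      have b1 := abs_le.1 (sqb _ hξ1.1 hξ1.2)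
      have b2 := abs_le.1 (sqb _ hη1.1 hη1.2)
      rw [e1] at b2
      set a := inner ℝ (ω : RSpace d) ξ
      constructor
      · rw [abs_le]
        constructor <;> nlinarith
      · have : a - (1 - ‖ξ‖ ^ 2 - r ^ 2) / (2 * r)
            = (‖ξ‖ ^ 2 + 2 * (r * a) + r ^ 2 - 1) / (2 * r) := by field_simp; ring
        rw [this, abs_div, abs_of_pos (by positivity : 0 < 2 * r)]
        gcongr
        exact abs_le.2 b2
    calc _ ≤ ENNReal.ofReal r * (d * (ENNReal.ofReal (8 * (5 * ε / (2 * r))) *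
          volume (ball (0 : RSpace d) 3))) := by
          gcongr
          refine (measure_mono hsub).trans (surfaceMeasure_slab_le ?_ ?_ _ _)
          · nlinarith
          · linarith
      _ = d * ((ENNReal.ofReal r * ENNReal.ofReal (8 * (5 * ε / (2 * r)))) *
            volume (ball (0 : RSpace d) 3)) := by ring
      _ = d * (ENNReal.ofReal (20 * ε) * volume (ball (0 : RSpace d) 3)) := by
          have : r * (8 * (5 * ε / (2 * r))) = 20 * ε := by field_simp; norm_num
          rw [← ENNReal.ofReal_mul hr.le, this]
      _ = _ := by
          rw [ENNReal.ofReal_mul (by norm_num)]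
          simp only [ENNReal.ofReal_ofNat]; ring

/-- Schur's bound for a radial kernel on a thin cap. -/
lemma exists_lintegral_shellCap_le (d : ℕ) (hd : 2 ≤ d) : ∃ C : ℝ≥0∞, C ≠ ∞ ∧
    ∀ (p : RSpace d) (ε : ℝ), 0 < ε → ε ≤ 1 / 20 → ∀ ξ ∈ shellCap p ε, ∀ g : ℝ → ℝ≥0∞,
      Measurable g → ∫⁻ η in shellCap p ε, g ‖η - ξ‖ ≤
        C * ENNReal.ofReal ε * ∫⁻ r in Ioi 0, ENNReal.ofReal (r ^ (d - 2)) * g r := by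
  obtain ⟨C, hC, hC'⟩ := exists_surfaceMeasure_shellCap_le d
  refine ⟨C, hC, fun p ε hε hε2 ξ hξ g hg => ?_⟩
  have hU := (isOpen_shellCap p ε).measurableSet
  have hUm : Measurable fun ζ => (shellCap p ε).indicator (1 : RSpace d → ℝ≥0∞) (ξ + ζ) :=
    (measurable_const.indicator hU).comp (by fun_prop)
  calc ∫⁻ η in shellCap p ε, g ‖η - ξ‖
      = ∫⁻ η, (shellCap p ε).indicator 1 η * g ‖η - ξ‖ := by
        rw [← lintegral_indicator hU]
        refine lintegral_congr fun η => ?_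
        by_cases h : η ∈ shellCap p ε <;> simp [h]
    _ = ∫⁻ ζ, (shellCap p ε).indicator 1 (ξ + ζ) * g ‖ζ‖ := by
        rw [← lintegral_add_left_eq_self _ ξ]
        simp
    _ = ∫⁻ r in Ioi (0 : ℝ), ENNReal.ofReal (r ^ (d - 1)) *
          ∫⁻ ω : USphere d, (shellCap p ε).indicator 1 (ξ + r • (ω : RSpace d)) *
            g ‖r • (ω : RSpace d)‖ ∂(surfaceMeasure d) :=
        lintegral_polar (by omega) (hUm.mul (hg.comp measurable_norm))
    -- One factor `r` of the polar weight is spent on the bound for the sphere of radius `r`; this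
    -- is how `r ^ (d - 2)` arises.
    _ ≤ ∫⁻ r in Ioi (0 : ℝ), C * ENNReal.ofReal ε * (ENNReal.ofReal (r ^ (d - 2)) * g r) := by
        refine setLIntegral_mono' measurableSet_Ioi fun r (hr : 0 < r) => ?_
        have e1 : ∀ ω : USphere d, ‖r • (ω : RSpace d)‖ = r := fun ω => by
          rw [norm_smul, norm_eq_of_mem_sphere ω, Real.norm_eq_abs, abs_of_pos hr, mul_one]
        have hms : MeasurableSet {ω : USphere d | ξ + r • (ω : RSpace d) ∈ shellCap p ε} :=
          hU.preimage (by fun_prop : Measurable fun ω : USphere d => ξ + r • (ω : RSpace d))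
        have e2 : ∫⁻ ω : USphere d, (shellCap p ε).indicator 1 (ξ + r • (ω : RSpace d)) *
            g ‖r • (ω : RSpace d)‖ ∂(surfaceMeasure d)
            = surfaceMeasure d {ω : USphere d | ξ + r • (ω : RSpace d) ∈ shellCap p ε} * g r := by
          simp_rw [e1]
          rw [lintegral_mul_const]
          · rw [← lintegral_indicator_one hms]
            rfl
          · exact hUm.comp (by fun_prop : Measurable fun ω : USphere d => r • (ω : RSpace d))
        rw [e2]
        have e3 : r ^ (d - 1) = r ^ (d - 2) * r := by
          rw [← pow_succ]; congr 1; omega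
        rw [e3, ENNReal.ofReal_mul (by positivity)]
        calc _ = ENNReal.ofReal (r ^ (d - 2)) * g r * (ENNReal.ofReal r *
              surfaceMeasure d {ω : USphere d | ξ + r • (ω : RSpace d) ∈ shellCap p ε}) := by ring
          _ ≤ ENNReal.ofReal (r ^ (d - 2)) * g r * (C * ENNReal.ofReal ε) := by
              exact mul_le_mul_right (hC' p ε hε hε2 ξ hξ r hr) _
          _ = _ := by ring
    _ = _ := by
        rw [lintegral_const_mul _ (by fun_prop)]

/-! ### Radial functions and the hyperdisk condition -/

/-- A property of almost every radius holds for the norm of almost every point. -/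
lemma ae_norm_of_ae {d : ℕ} (hd : 1 ≤ d) {P : ℝ → Prop} (hP : ∀ᵐ r : ℝ, 0 < r → P r) :
    ∀ᵐ x : RSpace d, P ‖x‖ := by
  have : Nonempty (Fin d) := ⟨⟨0, hd⟩⟩
  -- `P` need not be measurable, so polar coordinates are applied to a measurable null set
  -- containing the exceptional radii.
  set N := toMeasurable volume {r : ℝ | ¬ (0 < r → P r)}
  have hN0 : volume N = 0 := by rw [measure_toMeasurable]; exact hP
  have hNm : MeasurableSet N := measurableSet_toMeasurable _ _
  have h1 : ∫⁻ x : RSpace d, N.indicator (1 : ℝ → ℝ≥0∞) ‖x‖ = 0 := by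
    have hm : Measurable (N.indicator (1 : ℝ → ℝ≥0∞)) := measurable_const.indicator hNm
    rw [lintegral_polar (H := fun x : RSpace d => N.indicator (1 : ℝ → ℝ≥0∞) ‖x‖) hd
      (hm.comp measurable_norm)]
    have hae : ∀ᵐ r : ℝ, r ∉ N := measure_eq_zero_iff_ae_notMem.1 hN0
    rw [← lintegral_zero (μ := volume.restrict (Ioi (0 : ℝ)))]
    refine lintegral_congr_ae ?_
    filter_upwards [ae_restrict_of_ae hae, ae_restrict_mem measurableSet_Ioi] with r hr (hr0 : 0 < r)
    have e1 : ∀ ω : USphere d, ‖r • (ω : RSpace d)‖ = r := fun ω => by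
      rw [norm_smul, norm_eq_of_mem_sphere ω, Real.norm_eq_abs, abs_of_pos hr0, mul_one]
    simp [e1, hr]
  have h2 : ∀ᵐ x : RSpace d, N.indicator (1 : ℝ → ℝ≥0∞) ‖x‖ = 0 := by
    rwa [lintegral_eq_zero_iff (f := fun x : RSpace d => N.indicator (1 : ℝ → ℝ≥0∞) ‖x‖)
      ((measurable_const.indicator hNm).comp measurable_norm)] at h1
  have h3 : ∀ᵐ x : RSpace d, x ≠ 0 := by
    rw [ae_iff]; simp
  filter_upwards [h2, h3] with x hx hx0
  by_contra hc
  have : ‖x‖ ∈ N := subset_toMeasurable _ _ (by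
    simp only [mem_ofPred_eq]
    exact fun h => hc (h (norm_pos_iff.2 hx0)))
  simp [this] at hx

/-- A radial function which is integrable over a disk of codimension one is, almost everywhere on
the ball, dominated by a measurable function which is integrable against `r ^ (d - 2)`. -/
lemma exists_radial_majorant {d : ℕ} (hd : 2 ≤ d) {ψ : ℝ → ℂ}
    (hψ : IntegrableOn (fun ξ' : RSpace (d - 1) => ψ ‖ξ'‖) (closedBall 0 2)) :
    ∃ g : ℝ → ℝ≥0∞, Measurable g ∧
      ∫⁻ r in Ioi (0 : ℝ), ENNReal.ofReal (r ^ (d - 2)) * g r ≠ ∞ ∧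
      ∀ᵐ ζ : RSpace d, ‖ζ‖ < 2 → ‖ψ ‖ζ‖‖ₑ = g ‖ζ‖ := by
  have : Nonempty (Fin (d - 1)) := ⟨⟨0, by omega⟩⟩
  -- Polar coordinates in dimension `d - 1` make `r ^ (d - 2) • ψ r` integrable on `(0, 2)`.
  -- Dividing by the power then yields the almost everywhere measurability of `ψ`, which is not
  -- assumed.
  have h1 := (integrableOn_fun_norm_addHaar (E := RSpace (d - 1)) volume (f := ψ) (r := 2)).1
    (hψ.mono_set ball_subset_closedBall)
  rw [finrank_euclideanSpace_fin, Nat.sub_sub] at h1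
  have h2 : AEStronglyMeasurable ψ (volume.restrict (Ioo 0 2)) := by
    have h3 : AEStronglyMeasurable (fun y : ℝ => (y ^ (d - 2))⁻¹ • (y ^ (d - 2) • ψ y))
        (volume.restrict (Ioo 0 2)) :=
      (by fun_prop : Measurable fun y : ℝ => (y ^ (d - 2))⁻¹).aestronglyMeasurable.smul h1.1
    refine h3.congr ?_
    filter_upwards [ae_restrict_mem measurableSet_Ioo] with y hy
    rw [smul_smul, inv_mul_cancel₀ (pow_ne_zero _ hy.1.ne'), one_smul]
  refine ⟨(Ioo 0 2).indicator fun r => ‖h2.mk ψ r‖ₑ,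
    (h2.stronglyMeasurable_mk.measurable.enorm).indicator measurableSet_Ioo, ?_, ?_⟩
  · have h4 : ∫⁻ r in Ioi (0 : ℝ), ENNReal.ofReal (r ^ (d - 2)) *
        (Ioo (0 : ℝ) 2).indicator (fun r => ‖h2.mk ψ r‖ₑ) r
        = ∫⁻ r in Ioo (0 : ℝ) 2, ‖r ^ (d - 2) • ψ r‖ₑ := by
      rw [← lintegral_indicator measurableSet_Ioi, ← lintegral_indicator measurableSet_Ioo]
      have h5 := (ae_restrict_iff' measurableSet_Ioo).1 h2.ae_eq_mk
      refine lintegral_congr_ae ?_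
      filter_upwards [h5] with r hr
      by_cases hr2 : r ∈ Ioo (0 : ℝ) 2
      · rw [indicator_of_mem (show r ∈ Ioi (0 : ℝ) from hr2.1), indicator_of_mem hr2,
          indicator_of_mem hr2, ← hr hr2, enorm_smul, Real.enorm_of_nonneg (pow_nonneg hr2.1.le _)]
      · rw [indicator_of_notMem hr2]
        simp [hr2]
    rw [h4]
    exact h1.2.ne
  · refine ae_norm_of_ae (by omega) (P := fun r => r < 2 → ‖ψ r‖ₑ = _) ?_
    filter_upwards [(ae_restrict_iff' measurableSet_Ioo).1 h2.ae_eq_mk] with r hr h0 hr2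
    rw [indicator_of_mem (show r ∈ Ioo (0 : ℝ) 2 from ⟨h0, hr2⟩), ← hr ⟨h0, hr2⟩]

/-! ### Schur's test -/

lemma ENNReal.mul_le_sq_add_sq (a b : ℝ≥0∞) : a * b ≤ a ^ 2 + b ^ 2 := by
  rcases le_total a b with h | h
  · calc a * b ≤ b * b := mul_le_mul_left h b
      _ = b ^ 2 := (sq b).symm
      _ ≤ _ := le_add_self
  · calc a * b ≤ a * a := mul_le_mul_right h a
      _ = a ^ 2 := (sq a).symm
      _ ≤ _ := le_self_add

/-- Schur's test for a symmetric kernel. -/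
lemma lintegral_lintegral_le_of_schur {α : Type*} [MeasurableSpace α] {μ : Measure α} [SFinite μ]
    {U : Set α} (hU : MeasurableSet U) {k : α → α → ℝ≥0∞}
    (hk : Measurable fun q : α × α => k q.1 q.2) (hsymm : ∀ x y, k x y = k y x) {A : ℝ≥0∞}
    (hA : ∀ x ∈ U, ∫⁻ y in U, k x y ∂μ ≤ A) {w : α → ℝ≥0∞} (hw : Measurable w)
    (hw0 : ∀ x ∉ U, w x = 0) :
    ∫⁻ x, ∫⁻ y, k x y * (w x * w y) ∂μ ∂μ ≤ 2 * A * ∫⁻ x, w x ^ 2 ∂μ := by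
  have e1 : ∀ v : α → ℝ≥0∞, (∀ x ∉ U, v x = 0) → ∫⁻ x, v x ∂μ = ∫⁻ x in U, v x ∂μ := by
    intro v hv
    rw [← lintegral_indicator hU]
    refine lintegral_congr fun x => ?_
    by_cases hx : x ∈ U
    · rw [indicator_of_mem hx]
    · rw [indicator_of_notMem hx, hv x hx]
  have m1 : Measurable fun q : α × α => k q.1 q.2 * w q.1 ^ 2 :=
    hk.mul ((hw.comp measurable_fst).pow_const 2)
  have m2 : Measurable fun q : α × α => k q.2 q.1 * w q.2 ^ 2 := m1.comp measurable_swap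
  have key : ∫⁻ x in U, ∫⁻ y in U, k x y * w x ^ 2 ∂μ ∂μ ≤ A * ∫⁻ x, w x ^ 2 ∂μ := by
    rw [← lintegral_const_mul _ (hw.pow_const 2)]
    refine (setLIntegral_mono' hU fun x hx => ?_).trans (setLIntegral_le_lintegral U _)
    have hkx : Measurable (k x) := hk.comp measurable_prodMk_left
    rw [lintegral_mul_const _ hkx]
    exact mul_le_mul_left (hA x hx) _
  calc ∫⁻ x, ∫⁻ y, k x y * (w x * w y) ∂μ ∂μ
      = ∫⁻ x in U, ∫⁻ y in U, k x y * (w x * w y) ∂μ ∂μ := by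
        rw [e1 _ fun x hx => by simp [hw0 x hx]]
        refine lintegral_congr fun x => ?_
        rw [e1 _ fun y hy => by simp [hw0 y hy]]
    -- By symmetry of `k` and Tonelli both summands have the same integral, whence the factor `2`.
    _ ≤ ∫⁻ x in U, ∫⁻ y in U, (k x y * w x ^ 2 + k y x * w y ^ 2) ∂μ ∂μ := by
        refine lintegral_mono fun x => lintegral_mono fun y => ?_
        rw [hsymm y x, ← mul_add]
        exact mul_le_mul_right (ENNReal.mul_le_sq_add_sq _ _) _
    _ = ∫⁻ x in U, ((∫⁻ y in U, k x y * w x ^ 2 ∂μ) + ∫⁻ y in U, k y x * w y ^ 2 ∂μ) ∂μ :=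
        lintegral_congr fun x => lintegral_add_left (m1.comp measurable_prodMk_left) _
    _ = (∫⁻ x in U, ∫⁻ y in U, k x y * w x ^ 2 ∂μ ∂μ) +
          ∫⁻ x in U, ∫⁻ y in U, k y x * w y ^ 2 ∂μ ∂μ :=
        lintegral_add_left m1.lintegral_prod_right' _
    _ = (∫⁻ x in U, ∫⁻ y in U, k x y * w x ^ 2 ∂μ ∂μ) +
          ∫⁻ y in U, ∫⁻ x in U, k y x * w y ^ 2 ∂μ ∂μ := by
        congr 1
        exact lintegral_lintegral_swap (f := fun x y => k y x * w y ^ 2) m2.aemeasurable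
    _ ≤ A * (∫⁻ x, w x ^ 2 ∂μ) + A * ∫⁻ x, w x ^ 2 ∂μ := add_le_add key key
    _ = 2 * A * ∫⁻ x, w x ^ 2 ∂μ := by ring

/-- Schur's test for a radial kernel and functions supported in a thin cap. -/
lemma exists_schur_shellCap (d : ℕ) (hd : 2 ≤ d) : ∃ C : ℝ≥0∞, C ≠ ∞ ∧
    ∀ (p : RSpace d) (ε : ℝ), 0 < ε → ε ≤ 1 / 20 → ∀ g : ℝ → ℝ≥0∞, Measurable g →
      ∀ w : RSpace d → ℝ≥0∞, Measurable w → (∀ ξ ∉ shellCap p ε, w ξ = 0) →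
      ∫⁻ η, ∫⁻ ξ, g ‖ξ - η‖ * (w η * w ξ) ≤
        2 * (C * ENNReal.ofReal ε * (∫⁻ r in Ioi 0, ENNReal.ofReal (r ^ (d - 2)) * g r)) *
          ∫⁻ ξ, w ξ ^ 2 := by
  obtain ⟨C, hC, hC'⟩ := exists_lintegral_shellCap_le d hd
  exact ⟨C, hC, fun p ε hε hε2 g hg w hw hw0 => lintegral_lintegral_le_of_schur
    (isOpen_shellCap p ε).measurableSet (hg.comp (by fun_prop))
    (fun x y => by rw [norm_sub_rev]) (fun x hx => hC' p ε hε hε2 x hx g hg) hw hw0⟩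

/-! ### Wave integrals and autocorrelations -/

/-- The function `x ↦ ∫ G(η) e^{i x·η} dη`. -/
def waveIntegral {d : ℕ} (G : RSpace d → ℂ) (x : RSpace d) : ℂ := ∫ η, G η * planeWave x η

lemma planeWave_add {d : ℕ} (x ξ η : RSpace d) :
    planeWave x (ξ + η) = planeWave x ξ * planeWave x η := by
  simp only [planeWave, inner_add_right]
  rw [← Complex.exp_add]
  push_cast
  ring_nf

lemma conj_planeWave {d : ℕ} (x ξ : RSpace d) : conj (planeWave x ξ) = planeWave (-x) ξ := by
  simp only [planeWave, ← Complex.exp_conj, map_mul, Complex.conj_I, Complex.conj_ofReal,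
    inner_neg_left]
  push_cast
  ring_nf

lemma continuous_planeWave_right {d : ℕ} (x : RSpace d) : Continuous (planeWave x) :=
  continuous_planeWave.comp (by fun_prop : Continuous fun ξ : RSpace d => (x, ξ))

lemma continuous_planeWave_left {d : ℕ} (ξ : RSpace d) : Continuous fun x => planeWave x ξ :=
  continuous_planeWave.comp (by fun_prop : Continuous fun x : RSpace d => (x, ξ))

lemma integrable_planeWave_mul {d : ℕ} {G : RSpace d → ℂ} (hG : Integrable G) (x : RSpace d) :
    Integrable fun η => planeWave x η * G η :=
  hG.bdd_mul (c := 1) (continuous_planeWave_right x).aestronglyMeasurable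
    (Filter.Eventually.of_forall fun _ => (norm_planeWave _ _).le)

lemma continuous_waveIntegral {d : ℕ} {G : RSpace d → ℂ} (hG : Integrable G) :
    Continuous (waveIntegral G) := by
  refine continuous_of_dominated (bound := fun η => ‖G η‖) (fun x => ?_)
    (fun x => Filter.Eventually.of_forall fun η => ?_) hG.norm
    (Filter.Eventually.of_forall fun η => ?_)
  · exact hG.1.mul (continuous_planeWave_right x).aestronglyMeasurable
  · simp [norm_planeWave]
  · exact continuous_const.mul (continuous_planeWave_left η)

lemma norm_waveIntegral_sub_le {d : ℕ} {F G : RSpace d → ℂ} (hF : Integrable F)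
    (hG : Integrable G) (x : RSpace d) :
    ‖waveIntegral F x - waveIntegral G x‖ ≤ ∫ η, ‖F η - G η‖ := by
  have hF' : Integrable fun η => F η * planeWave x η := by
    simpa only [mul_comm] using integrable_planeWave_mul hF x
  have hG' : Integrable fun η => G η * planeWave x η := by
    simpa only [mul_comm] using integrable_planeWave_mul hG x
  rw [waveIntegral, waveIntegral, ← integral_sub hF' hG']
  refine (norm_integral_le_integral_norm _).trans_eq (integral_congr_ae (.of_forall fun η => ?_))
  simp only
  rw [← sub_mul, norm_mul, norm_planeWave, mul_one]

/-- The autocorrelation `ζ ↦ ∫ G(η) conj(G(η + ζ)) dη`, written as a convolution. -/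
def autocorr {d : ℕ} (G : RSpace d → ℂ) : RSpace d → ℂ :=
  (fun t => G (-t)) ⋆[ContinuousLinearMap.mul ℝ ℂ, volume] (fun t => conj (G t))

/-- Plane waves are characters, so multiplication by one distributes over the convolution. The
integral of the resulting convolution is the product of `waveIntegral G x` and its conjugate. In
this way the weighted integral of `|waveIntegral G|²` becomes a pairing with the Fourier transform
of a test function. -/
lemma unitaryFourier_autocorr {d : ℕ} {G : RSpace d → ℂ} (hG : Integrable G) (x : RSpace d) :
    unitaryFourier (autocorr G) x =
      (((2 * Real.pi) ^ (-(d : ℝ) / 2) * ‖waveIntegral G x‖ ^ 2 : ℝ) : ℂ) := by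
  have hGc : Integrable fun t => conj (G t) := by
    refine hG.norm.mono' ?_ (.of_forall fun t => by simp)
    exact Complex.continuous_conj.comp_aestronglyMeasurable hG.1
  have h1 : (fun ζ => planeWave (-x) ζ * autocorr G ζ) =
      (fun t => planeWave (-x) t * G (-t)) ⋆[ContinuousLinearMap.mul ℝ ℂ, volume]
        (fun t => planeWave (-x) t * conj (G t)) := by
    funext ζ
    simp only [autocorr, convolution_def, ContinuousLinearMap.mul_apply']
    rw [← integral_const_mul]
    refine integral_congr_ae (.of_forall fun t => ?_)
    have h2 : planeWave (-x) ζ = planeWave (-x) t * planeWave (-x) (ζ - t) := by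
      rw [← planeWave_add]; congr 1; abel
    simp only [h2]
    ring
  have h3 : ∫ t, planeWave (-x) t * G (-t) = waveIntegral G x := by
    rw [← integral_neg_eq_self, waveIntegral]
    refine integral_congr_ae (.of_forall fun t => ?_)
    simp [planeWave, mul_comm]
  have h4 : ∫ t, planeWave (-x) t * conj (G t) = conj (waveIntegral G x) := by
    rw [waveIntegral, ← integral_conj]
    refine integral_congr_ae (.of_forall fun t => ?_)
    simp only [map_mul, conj_planeWave]
    ring
  rw [unitaryFourier, h1, integral_convolution _ (integrable_planeWave_mul hG.comp_neg _)
    (integrable_planeWave_mul hGc _), h3, h4, ContinuousLinearMap.mul_apply', Complex.mul_conj']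
  push_cast
  ring

lemma unitaryFourier_eq_fourier {d : ℕ} (k : 𝓢(RSpace d, ℂ)) (x : RSpace d) :
    unitaryFourier k x = ((2 * Real.pi) ^ (-(d : ℝ) / 2) : ℝ) *
      (FourierTransform.fourier k) ((2 * Real.pi)⁻¹ • x) := by
  rw [unitaryFourier, SchwartzMap.fourier_coe, Real.fourier_eq']
  congr 1
  refine integral_congr_ae (.of_forall fun ξ => ?_)
  simp only [planeWave, inner_smul_right, smul_eq_mul, inner_neg_left]
  congr 2
  rw [real_inner_comm]
  push_cast
  field_simp

lemma continuous_unitaryFourier {d : ℕ} (k : 𝓢(RSpace d, ℂ)) : Continuous (unitaryFourier k) := by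
  have : unitaryFourier k = fun x => ((2 * Real.pi) ^ (-(d : ℝ) / 2) : ℝ) *
      (FourierTransform.fourier k) ((2 * Real.pi)⁻¹ • x) :=
    funext (unitaryFourier_eq_fourier k)
  rw [this]
  exact continuous_const.mul ((SchwartzMap.continuous _).comp (by fun_prop))

lemma exists_unitaryFourier_decay {d : ℕ} (k : 𝓢(RSpace d, ℂ)) (N : ℕ) :
    ∃ M : ℝ, ∀ x, (1 + ‖x‖) ^ N * ‖unitaryFourier k x‖ ≤ M := by
  have hπ : 1 ≤ 2 * Real.pi := by linarith [Real.pi_gt_three]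
  refine ⟨(2 * Real.pi) ^ N * (((2 * Real.pi) ^ (-(d : ℝ) / 2) : ℝ) *
    (2 ^ N * (Finset.Iic (N, 0)).sup (fun m => SchwartzMap.seminorm ℝ m.1 m.2)
      (FourierTransform.fourier k))), fun x => ?_⟩
  have h := SchwartzMap.one_add_le_sup_seminorm_apply (𝕜 := ℝ) (m := (N, 0)) (k := N) (n := 0)
    le_rfl le_rfl (FourierTransform.fourier k) ((2 * Real.pi)⁻¹ • x)
  rw [norm_iteratedFDeriv_zero] at h
  have h1 : 1 + ‖x‖ ≤ 2 * Real.pi * (1 + ‖(2 * Real.pi)⁻¹ • x‖) := by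
    rw [norm_smul, norm_inv, Real.norm_of_nonneg (by positivity), mul_add, ← mul_assoc,
      mul_inv_cancel₀ (by positivity), one_mul, mul_one]
    linarith
  have h0 : (0 : ℝ) ≤ (2 * Real.pi) ^ (-(d : ℝ) / 2) := by positivity
  rw [unitaryFourier_eq_fourier, norm_mul, Complex.norm_real, Real.norm_of_nonneg h0]
  calc _ ≤ (2 * Real.pi * (1 + ‖(2 * Real.pi)⁻¹ • x‖)) ^ N *
        ((2 * Real.pi) ^ (-(d : ℝ) / 2) *
          ‖(FourierTransform.fourier k) ((2 * Real.pi)⁻¹ • x)‖) := by gcongr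
    _ = (2 * Real.pi) ^ N * ((2 * Real.pi) ^ (-(d : ℝ) / 2) *
          ((1 + ‖(2 * Real.pi)⁻¹ • x‖) ^ N *
            ‖(FourierTransform.fourier k) ((2 * Real.pi)⁻¹ • x)‖)) := by
        rw [mul_pow]; ring
    _ ≤ _ := by gcongr

lemma contDiff_autocorr {d : ℕ} {G : RSpace d → ℂ} (hG : ContDiff ℝ (⊤ : ℕ∞) G)
    (hGc : HasCompactSupport G) : ContDiff ℝ (⊤ : ℕ∞) (autocorr G) := by
  refine HasCompactSupport.contDiff_convolution_right _ ?_ ?_ ?_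
  · exact hGc.comp_left (g := (starRingEnd ℂ : ℂ → ℂ)) (map_zero _)
  · exact (hG.continuous.comp continuous_neg).locallyIntegrable
  · exact Complex.conjCLE.contDiff.comp hG

/-- Where the integrand does not vanish, `-t` and `ζ - t` both lie in the cap, and they differ by
`ζ`. -/
lemma autocorr_eq_zero {d : ℕ} {G : RSpace d → ℂ} {p : RSpace d} {ε : ℝ}
    (hGU : ∀ ξ ∉ shellCap p ε, G ξ = 0) {ζ : RSpace d} (hζ : 1 / 2 ≤ ‖ζ‖) :
    autocorr G ζ = 0 := by
  rw [autocorr, convolution_def]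
  refine integral_eq_zero_of_ae (.of_forall fun t => ?_)
  simp only [ContinuousLinearMap.mul_apply', Pi.zero_apply, mul_eq_zero]
  by_contra! hc
  have h1 : -t ∈ shellCap p ε := by
    by_contra h; exact hc.1 (hGU _ h)
  have h2 : ζ - t ∈ shellCap p ε := by
    by_contra h; exact hc.2 (by rw [hGU _ h, map_zero])
  have h3 := dist_lt_of_mem_shellCap h2 h1
  rw [dist_eq_norm, show ζ - t - -t = ζ by abel] at h3
  linarith

lemma enorm_autocorr_le {d : ℕ} (G : RSpace d → ℂ) (ζ : RSpace d) :
    ‖autocorr G ζ‖ₑ ≤ ∫⁻ η, ‖G η‖ₑ * ‖G (ζ + η)‖ₑ := by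
  rw [autocorr, convolution_def]
  refine (enorm_integral_le_lintegral_enorm _).trans_eq ?_
  rw [← lintegral_neg_eq_self]
  refine lintegral_congr fun η => ?_
  simp [enorm_mul]

/-- Substituting `ξ = ζ + η` produces the symmetric kernel `g ‖ξ - η‖` to which Schur's test
applies. -/
lemma lintegral_autocorr_le {d : ℕ} {G : RSpace d → ℂ} (hG : Measurable G) {g : ℝ → ℝ≥0∞}
    (hg : Measurable g) :
    ∫⁻ ζ, g ‖ζ‖ * ‖autocorr G ζ‖ₑ ≤ ∫⁻ η, ∫⁻ ξ, g ‖ξ - η‖ * (‖G η‖ₑ * ‖G ξ‖ₑ) := by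
  have hm : Measurable fun q : RSpace d × RSpace d =>
      g ‖q.1‖ * (‖G q.2‖ₑ * ‖G (q.1 + q.2)‖ₑ) := by
    have h1 : Measurable fun q : RSpace d × RSpace d => g ‖q.1‖ := hg.comp (by fun_prop)
    have h2 : Measurable fun q : RSpace d × RSpace d => G (q.1 + q.2) := hG.comp (by fun_prop)
    exact h1.mul ((hG.comp measurable_snd).enorm.mul h2.enorm)
  calc ∫⁻ ζ, g ‖ζ‖ * ‖autocorr G ζ‖ₑ
      ≤ ∫⁻ ζ, g ‖ζ‖ * ∫⁻ η, ‖G η‖ₑ * ‖G (ζ + η)‖ₑ :=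
        lintegral_mono fun ζ => mul_le_mul_right (enorm_autocorr_le G ζ) _
    _ = ∫⁻ ζ, ∫⁻ η, g ‖ζ‖ * (‖G η‖ₑ * ‖G (ζ + η)‖ₑ) := by
        refine lintegral_congr fun ζ => (lintegral_const_mul _ ?_).symm
        exact hG.enorm.mul (hG.comp (measurable_const_add ζ)).enorm
    _ = ∫⁻ η, ∫⁻ ζ, g ‖ζ‖ * (‖G η‖ₑ * ‖G (ζ + η)‖ₑ) :=
        lintegral_lintegral_swap (f := fun ζ η => g ‖ζ‖ * (‖G η‖ₑ * ‖G (ζ + η)‖ₑ)) hm.aemeasurable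
    _ = ∫⁻ η, ∫⁻ ξ, g ‖ξ - η‖ * (‖G η‖ₑ * ‖G ξ‖ₑ) := by
        refine lintegral_congr fun η => ?_
        rw [← lintegral_add_right_eq_self (fun ξ => g ‖ξ - η‖ * (‖G η‖ₑ * ‖G ξ‖ₑ)) η]
        simp only [add_sub_cancel_right]

/-! ### The weighted estimate for smooth functions near the sphere -/

namespace IsAdmissibleRadialGauge

variable {d : ℕ} {φ : ℝ → ℝ}

/-- Positivity is required only on `(0, ∞)`, so the origin has to be discarded as a null set. -/
lemma ae_nonneg (hφ : IsAdmissibleRadialGauge d φ) (hd : 2 ≤ d) :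
    ∀ᵐ x : RSpace d, 0 ≤ φ ‖x‖ :=
  ae_norm_of_ae (by omega) (P := fun r => 0 ≤ φ r) (.of_forall fun r hr => (hφ.pos r hr).le)

lemma aemeasurable (hφ : IsAdmissibleRadialGauge d φ) :
    AEMeasurable fun x : RSpace d => ENNReal.ofReal (φ ‖x‖) :=
  hφ.locallyIntegrable.aestronglyMeasurable.aemeasurable.ennreal_ofReal

/-- Schwartz decay beats tempered growth. Integrability is what allows the Bochner integral in the
field `fourier` to be read as a Lebesgue integral of a nonnegative function, since Bochner integrals
default to zero otherwise. -/
lemma integrable_mul_unitaryFourier (hφ : IsAdmissibleRadialGauge d φ) (k : 𝓢(RSpace d, ℂ)) :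
    Integrable fun x : RSpace d => (φ ‖x‖ : ℂ) * unitaryFourier k x := by
  obtain ⟨N, hN⟩ := hφ.tempered
  obtain ⟨M, hM⟩ := exists_unitaryFourier_decay k N
  have h := hN.ofReal (𝕜 := ℂ)
  have h2 := h.mul_bdd (g := fun x => ((1 + ‖x‖ : ℝ) : ℂ) ^ N * unitaryFourier k x) (c := M) ?_ ?_
  · refine h2.congr (.of_forall fun x => ?_)
    have : ((1 + ‖x‖ : ℝ) : ℂ) ≠ 0 := by
      rw [Ne, Complex.ofReal_eq_zero]; positivity
    simp only [Complex.coe_algebraMap, Complex.ofReal_div, Complex.ofReal_pow]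
    field_simp
  · refine Continuous.aestronglyMeasurable ?_
    have := continuous_unitaryFourier k
    fun_prop
  · refine .of_forall fun x => ?_
    rw [norm_mul, norm_pow, Complex.norm_real, Real.norm_of_nonneg (by positivity)]
    exact hM x

/-- The weighted estimate for smooth functions supported in a thin cap. -/
lemma exists_lintegral_waveIntegral_smooth_le (hφ : IsAdmissibleRadialGauge d φ) (hd : 2 ≤ d) :
    ∃ C : ℝ≥0∞, C ≠ ∞ ∧ ∀ (p : RSpace d) (ε : ℝ), 0 < ε → ε ≤ 1 / 20 →
      ∀ G : RSpace d → ℂ, ContDiff ℝ (⊤ : ℕ∞) G → HasCompactSupport G →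
      (∀ ξ ∉ shellCap p ε, G ξ = 0) →
      ∫⁻ x, ENNReal.ofReal (φ ‖x‖) * ‖waveIntegral G x‖ₑ ^ 2 ≤
        C * ENNReal.ofReal ε * ∫⁻ ξ, ‖G ξ‖ₑ ^ 2 := by
  obtain ⟨ψ, hψ1, hψ2⟩ := hφ.fourier
  obtain ⟨g, hg, hgi, hgψ⟩ := exists_radial_majorant hd hψ2
  obtain ⟨C, hC, hC'⟩ := exists_schur_shellCap d hd
  set c : ℝ := (2 * Real.pi) ^ (-(d : ℝ) / 2) with hc
  have hc0 : 0 < c := by have := Real.pi_pos; positivity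
  set M := ∫⁻ r in Ioi 0, ENNReal.ofReal (r ^ (d - 2)) * g r
  refine ⟨(ENNReal.ofReal c)⁻¹ * (2 * (C * M)), ?_, fun p ε hε hε2 G hG hGc hGU => ?_⟩
  · have : ENNReal.ofReal c ≠ 0 := by simpa using hc0
    exact ENNReal.mul_ne_top (ENNReal.inv_ne_top.2 this) (by finiteness)
  have hGi : Integrable G := hG.continuous.integrable_of_hasCompactSupport hGc
  have hsupp : tsupport (autocorr G) ⊆ closedBall 0 (1 / 2) := by
    refine closure_minimal (fun ζ hζ => ?_) isClosed_closedBall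
    rw [mem_closedBall_zero_iff]
    by_contra! hlt
    exact hζ (autocorr_eq_zero hGU hlt.le)
  have hkc : HasCompactSupport (autocorr G) :=
    (isCompact_closedBall _ _).of_isClosed_subset (isClosed_tsupport _) hsupp
  set k := hkc.toSchwartzMap (contDiff_autocorr hG hGc) with hk
  have hkG : ⇑k = autocorr G := rfl
  have e1 := hψ1 k (by
    rw [hkG]
    exact hsupp.trans (closedBall_subset_ball (by norm_num)))
  have hint := hφ.integrable_mul_unitaryFourier k
  rw [hkG] at e1 hint
  simp only [unitaryFourier_autocorr hGi, ← Complex.ofReal_mul, ← hc] at e1 hint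
  rw [integral_complex_ofReal] at e1
  have hint' : Integrable fun x : RSpace d => φ ‖x‖ * (c * ‖waveIntegral G x‖ ^ 2) := by
    simpa only [RCLike.re_to_complex, Complex.ofReal_re] using hint.re
  have hnn : 0 ≤ᵐ[volume] fun x : RSpace d => φ ‖x‖ * (c * ‖waveIntegral G x‖ ^ 2) := by
    filter_upwards [hφ.ae_nonneg hd] with x hx
    simp only [Pi.zero_apply]
    positivity
  -- The left side of `e1` has an almost everywhere nonnegative integrand, so nothing is lost here;
  -- absolute values enter only on the side of `ψ`.
  have e2 : ENNReal.ofReal c * ∫⁻ x, ENNReal.ofReal (φ ‖x‖) * ‖waveIntegral G x‖ₑ ^ 2 =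
      ‖∫ ξ : RSpace d, ψ ‖ξ‖ * autocorr G ξ‖ₑ := by
    rw [← e1, ← lintegral_const_mul' _ _ ENNReal.ofReal_ne_top]
    have : ‖((∫ x : RSpace d, φ ‖x‖ * (c * ‖waveIntegral G x‖ ^ 2) : ℝ) : ℂ)‖ₑ =
        ENNReal.ofReal (∫ x : RSpace d, φ ‖x‖ * (c * ‖waveIntegral G x‖ ^ 2)) := by
      rw [← ofReal_norm, Complex.norm_real, Real.norm_of_nonneg (integral_nonneg_of_ae hnn)]
    refine Eq.trans ?_ this.symm
    rw [ofReal_integral_eq_lintegral_ofReal hint' hnn]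
    refine lintegral_congr_ae ?_
    filter_upwards [hφ.ae_nonneg hd] with x hx
    rw [ENNReal.ofReal_mul hx, ENNReal.ofReal_mul hc0.le, ENNReal.ofReal_pow (norm_nonneg _),
      ofReal_norm]
    ring
  have e3 : ‖∫ ξ : RSpace d, ψ ‖ξ‖ * autocorr G ξ‖ₑ ≤
      2 * (C * ENNReal.ofReal ε * M) * ∫⁻ ξ, ‖G ξ‖ₑ ^ 2 := by
    calc _ ≤ ∫⁻ ξ : RSpace d, ‖ψ ‖ξ‖ * autocorr G ξ‖ₑ := enorm_integral_le_lintegral_enorm _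
      _ = ∫⁻ ξ : RSpace d, g ‖ξ‖ * ‖autocorr G ξ‖ₑ := by
        refine lintegral_congr_ae ?_
        filter_upwards [hgψ] with ξ hξ
        rw [enorm_mul]
        rcases lt_or_ge ‖ξ‖ 2 with h | h
        · rw [hξ h]
        · rw [autocorr_eq_zero hGU (by linarith)]; simp
      _ ≤ ∫⁻ η, ∫⁻ ξ, g ‖ξ - η‖ * (‖G η‖ₑ * ‖G ξ‖ₑ) :=
        lintegral_autocorr_le hG.continuous.measurable hg
      _ ≤ _ := hC' p ε hε hε2 g hg (fun ξ => ‖G ξ‖ₑ) hG.continuous.measurable.enorm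
          fun ξ hξ => by simp [hGU ξ hξ]
  have hcne : ENNReal.ofReal c ≠ 0 := by simpa using hc0
  rw [← e2] at e3
  calc ∫⁻ x, ENNReal.ofReal (φ ‖x‖) * ‖waveIntegral G x‖ₑ ^ 2
      = (ENNReal.ofReal c)⁻¹ * (ENNReal.ofReal c *
          ∫⁻ x, ENNReal.ofReal (φ ‖x‖) * ‖waveIntegral G x‖ₑ ^ 2) := by
        rw [← mul_assoc, ENNReal.inv_mul_cancel hcne ENNReal.ofReal_ne_top, one_mul]
    _ ≤ (ENNReal.ofReal c)⁻¹ * (2 * (C * ENNReal.ofReal ε * M) * ∫⁻ ξ, ‖G ξ‖ₑ ^ 2) :=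
        mul_le_mul_right e3 _
    _ = _ := by ring

end IsAdmissibleRadialGauge

/-! ### Passage to square integrable functions -/

/-- A form of Fatou's lemma. -/
lemma lintegral_le_of_tendsto_of_le {α : Type*} [MeasurableSpace α] {μ : Measure α}
    {f : ℕ → α → ℝ≥0∞} {F : α → ℝ≥0∞} {b : ℕ → ℝ≥0∞} {B : ℝ≥0∞}
    (hf : ∀ n, AEMeasurable (f n) μ) (hF : ∀ x, Tendsto (fun n => f n x) atTop (𝓝 (F x)))
    (hb : ∀ n, ∫⁻ x, f n x ∂μ ≤ b n) (hB : Tendsto b atTop (𝓝 B)) : ∫⁻ x, F x ∂μ ≤ B := by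
  calc ∫⁻ x, F x ∂μ = ∫⁻ x, liminf (fun n => f n x) atTop ∂μ :=
        lintegral_congr fun x => (hF x).liminf_eq.symm
    _ ≤ liminf (fun n => ∫⁻ x, f n x ∂μ) atTop := lintegral_liminf_le' hf
    _ ≤ liminf b atTop := liminf_le_liminf (.of_forall hb)
    _ = B := hB.liminf_eq

lemma IsAdmissibleRadialGauge.lintegral_le_of_tendsto {d : ℕ} {φ : ℝ → ℝ}
    (hφ : IsAdmissibleRadialGauge d φ) {f : ℕ → RSpace d → ℂ} {F : RSpace d → ℂ}
    {b : ℕ → ℝ≥0∞} {B : ℝ≥0∞} (hf : ∀ n, Continuous (f n))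
    (hF : ∀ x, Tendsto (fun n => f n x) atTop (𝓝 (F x)))
    (hb : ∀ n, ∫⁻ x, ENNReal.ofReal (φ ‖x‖) * ‖f n x‖ₑ ^ 2 ≤ b n) (hB : Tendsto b atTop (𝓝 B)) :
    ∫⁻ x, ENNReal.ofReal (φ ‖x‖) * ‖F x‖ₑ ^ 2 ≤ B := by
  refine lintegral_le_of_tendsto_of_le
    (fun n => hφ.aemeasurable.mul ((hf n).measurable.enorm.pow_const 2).aemeasurable)
    (fun x => ?_) hb hB
  refine ENNReal.Tendsto.const_mul ?_ (Or.inr ENNReal.ofReal_ne_top)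
  exact ENNReal.Tendsto.pow (hF x).enorm

lemma lintegral_enorm_sq_eq {α : Type*} [MeasurableSpace α] {μ : Measure α} (f : α → ℂ) :
    ∫⁻ x, ‖f x‖ₑ ^ 2 ∂μ = eLpNorm f 2 μ ^ 2 := by
  have := eLpNorm_nnreal_pow_eq_lintegral (f := f) (μ := μ) (p := 2) (by norm_num)
  simpa using this.symm

/-- The weighted estimate for square integrable functions supported in a thin cap. -/
lemma IsAdmissibleRadialGauge.exists_lintegral_waveIntegral_le {d : ℕ} {φ : ℝ → ℝ}
    (hφ : IsAdmissibleRadialGauge d φ) (hd : 2 ≤ d) :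
    ∃ C : ℝ≥0∞, C ≠ ∞ ∧ ∀ (p : RSpace d) (ε : ℝ), 0 < ε → ε ≤ 1 / 20 →
      ∀ (F : RSpace d → ℂ) (K : Set (RSpace d)), MemLp F 2 → IsClosed K → K ⊆ shellCap p ε →
      (∀ ξ ∉ K, F ξ = 0) →
      ∫⁻ x, ENNReal.ofReal (φ ‖x‖) * ‖waveIntegral F x‖ₑ ^ 2 ≤
        C * ENNReal.ofReal ε * ∫⁻ ξ, ‖F ξ‖ₑ ^ 2 := by
  obtain ⟨C, hC, hC'⟩ := hφ.exists_lintegral_waveIntegral_smooth_le hd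
  refine ⟨C, hC, fun p ε hε hε2 F K hF hK hKU hF0 => ?_⟩
  obtain ⟨χ, hχ0, hχ1, hχ⟩ := exists_contMDiffMap_zero_one_of_isClosed
    (n := (⊤ : ℕ∞)) (modelWithCornersSelf ℝ (RSpace d)) (isOpen_shellCap p ε).isClosed_compl hK
    (disjoint_left.2 fun x hx hx' => hx (hKU hx'))
  have hχs : ContDiff ℝ (⊤ : ℕ∞) (fun x => (χ x : ℂ)) :=
    Complex.ofRealCLM.contDiff.comp χ.contMDiff.contDiff
  have happ : ∀ n : ℕ, ∃ G : RSpace d → ℂ, HasCompactSupport G ∧ ContDiff ℝ (⊤ : ℕ∞) G ∧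
      (∀ ξ ∉ shellCap p ε, G ξ = 0) ∧
      eLpNorm (F - G) 2 volume ≤ ENNReal.ofReal (1 / ((n : ℝ) + 1)) := by
    intro n
    obtain ⟨G, hG1, hG2, hG3⟩ := MemLp.exist_eLpNorm_sub_le (by norm_num) (by norm_num) hF
      (by positivity : 0 < 1 / ((n : ℝ) + 1))
    refine ⟨fun x => (χ x : ℂ) * G x, hG1.mul_left, hχs.mul hG2, fun ξ hξ => ?_, ?_⟩
    · simp [hχ0 hξ]
    · refine le_trans (eLpNorm_mono fun x => ?_) hG3
      -- As `χ = 1` on `K` and `F = 0` off `K`, one has `F = χ F`. Hence cutting `G` off to the cap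
      -- does not increase the error.
      have e1 : (F - fun x => (χ x : ℂ) * G x) x = (χ x : ℂ) * (F - G) x := by
        simp only [Pi.sub_apply]
        by_cases hx : x ∈ K
        · simp [hχ1 hx]
        · simp [hF0 x hx]
      rw [e1, norm_mul, Complex.norm_real, Real.norm_of_nonneg (hχ x).1]
      exact mul_le_of_le_one_left (norm_nonneg _) (hχ x).2
  choose G hG1 hG2 hG3 hG4 using happ
  have hUf : volume (shellCap p ε) ≠ ∞ :=
    ((measure_mono fun ξ hξ => hξ.2).trans_lt (measure_ball_lt_top (x := p) (r := 1 / 4))).ne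
  -- The cap has finite volume, so convergence in `L²` implies convergence in `L¹` and hence uniform
  -- convergence of the wave integrals, as needed for Fatou.
  have hL1 : ∀ f : RSpace d → ℂ, AEStronglyMeasurable f → (∀ ξ ∉ shellCap p ε, f ξ = 0) →
      eLpNorm f 1 volume ≤ eLpNorm f 2 volume * volume (shellCap p ε) ^ (1 / 2 : ℝ) := by
    intro f hf hf0
    have hsupp : Function.support f ⊆ shellCap p ε := fun x hx => by
      by_contra h; exact hx (hf0 x h)
    rw [← eLpNorm_restrict_eq_of_support_subset hsupp,
      ← eLpNorm_restrict_eq_of_support_subset (p := 2) hsupp]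
    have := eLpNorm_le_eLpNorm_mul_rpow_measure_univ (p := 1) (q := 2) (by norm_num)
      (hf.restrict (s := shellCap p ε))
    rw [Measure.restrict_apply_univ] at this
    convert this using 2
    norm_num
  have hFU : ∀ ξ ∉ shellCap p ε, F ξ = 0 := fun ξ hξ => hF0 ξ fun h => hξ (hKU h)
  have hFi : Integrable F := by
    rw [← memLp_one_iff_integrable]
    exact ⟨hF.1, (hL1 F hF.1 hFU).trans_lt (ENNReal.mul_lt_top hF.2
      (ENNReal.rpow_lt_top_of_nonneg (by norm_num) hUf))⟩
  have hGi : ∀ n, Integrable (G n) := fun n =>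
    (hG2 n).continuous.integrable_of_hasCompactSupport (hG1 n)
  have hdiff : ∀ n x, edist (waveIntegral (G n) x) (waveIntegral F x) ≤
      ENNReal.ofReal (1 / ((n : ℝ) + 1)) * volume (shellCap p ε) ^ (1 / 2 : ℝ) := by
    intro n x
    rw [edist_comm, edist_dist, dist_eq_norm]
    calc _ ≤ ENNReal.ofReal (∫ η, ‖F η - G n η‖) :=
          ENNReal.ofReal_le_ofReal (norm_waveIntegral_sub_le hFi (hGi n) x)
      _ = eLpNorm (F - G n) 1 volume := by
          rw [eLpNorm_one_eq_lintegral_enorm]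
          exact ofReal_integral_norm_eq_lintegral_enorm (hFi.sub (hGi n))
      _ ≤ _ := (hL1 _ (hF.1.sub (hGi n).1) fun ξ hξ => by simp [hFU ξ hξ, hG3 n ξ hξ]).trans
          (mul_le_mul_left (hG4 n) _)
  have hlim : Tendsto (fun n : ℕ => ENNReal.ofReal (1 / ((n : ℝ) + 1))) atTop (𝓝 0) := by
    rw [← ENNReal.ofReal_zero]
    exact ENNReal.tendsto_ofReal tendsto_one_div_add_atTop_nhds_zero_nat
  refine hφ.lintegral_le_of_tendsto (f := fun n => waveIntegral (G n))
    (b := fun n => C * ENNReal.ofReal ε *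
      (eLpNorm F 2 volume + ENNReal.ofReal (1 / ((n : ℝ) + 1))) ^ 2)
    (fun n => continuous_waveIntegral (hGi n)) (fun x => ?_) (fun n => ?_) ?_
  · rw [tendsto_iff_edist_tendsto_0]
    refine tendsto_of_tendsto_of_tendsto_of_le_of_le tendsto_const_nhds ?_
      (fun n => zero_le) fun n => hdiff n x
    have := ENNReal.Tendsto.mul_const (b := volume (shellCap p ε) ^ (1 / 2 : ℝ)) hlim
      (Or.inr (ENNReal.rpow_ne_top_of_nonneg (by norm_num) hUf))
    simpa using this
  · refine (hC' p ε hε hε2 (G n) (hG2 n) (hG1 n) (hG3 n)).trans ?_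
    rw [lintegral_enorm_sq_eq]
    gcongr
    calc eLpNorm (G n) 2 volume = eLpNorm (F - (F - G n)) 2 volume := by rw [sub_sub_cancel]
      _ ≤ eLpNorm F 2 volume + eLpNorm (F - G n) 2 volume :=
          eLpNorm_sub_le hF.1 (hF.1.sub (hGi n).1) (by norm_num)
      _ ≤ _ := by gcongr; exact hG4 n
  · rw [lintegral_enorm_sq_eq]
    refine ENNReal.Tendsto.const_mul (ENNReal.Tendsto.pow ?_) (Or.inr (by finiteness))
    simpa using hlim.const_add (eLpNorm F 2 volume)

/-! ### From shells to densities on the sphere -/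

/-- The function `x ↦ ∫ f(ω) e^{i x·ω} dS(ω)`. -/
def sphereWave {d : ℕ} (f : USphere d → ℂ) (x : RSpace d) : ℂ :=
  ∫ ω, f ω * planeWave x ω ∂(surfaceMeasure d)

lemma integrable_sphereWave {d : ℕ} {f : USphere d → ℂ} (hf : Integrable f (surfaceMeasure d))
    (x : RSpace d) : Integrable (fun ω : USphere d => f ω * planeWave x ω) (surfaceMeasure d) :=
  hf.mul_bdd (c := 1)
    ((continuous_planeWave_right x).comp continuous_subtype_val).aestronglyMeasurable
    (.of_forall fun _ => (norm_planeWave _ _).le)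

lemma continuous_sphereWave {d : ℕ} {f : USphere d → ℂ} (hf : Integrable f (surfaceMeasure d)) :
    Continuous (sphereWave f) := by
  refine continuous_of_dominated (bound := fun ω => ‖f ω‖)
    (fun x => (integrable_sphereWave hf x).1) (fun x => .of_forall fun ω => ?_) hf.norm
    (.of_forall fun ω => continuous_const.mul (continuous_planeWave_left _))
  simp [norm_planeWave]

lemma norm_planeWave_sub_le {d : ℕ} (x ξ η : RSpace d) :
    ‖planeWave x ξ - planeWave x η‖ ≤ ‖x‖ * ‖ξ - η‖ := by
  have h1 : planeWave x ξ - planeWave x η = planeWave x η * (planeWave x (ξ - η) - 1) := by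
    rw [mul_sub, ← planeWave_add, mul_one]; congr 2; abel
  rw [h1, norm_mul, norm_planeWave, one_mul, planeWave]
  exact (Real.norm_exp_I_mul_ofReal_sub_one_le).trans (norm_inner_le_norm _ _)

/-- The radii in the interval `(1 - ε, 1)`. -/
def radialWindow (ε : ℝ) : Set (Ioi (0 : ℝ)) := {r | 1 - ε < r ∧ (r : ℝ) < 1}

lemma measurableSet_radialWindow (ε : ℝ) : MeasurableSet (radialWindow ε) := by
  simp only [radialWindow, Set.ofPred_and]
  exact (measurableSet_lt (by fun_prop) (by fun_prop)).inter
    (measurableSet_lt (by fun_prop) (by fun_prop))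

/-- On the window the weight `r ^ n` is at least `(1 / 2) ^ n`, because `r > 19 / 20`. -/
lemma volumeIoiPow_radialWindow_ge (n : ℕ) {ε : ℝ} (hε2 : ε ≤ 1 / 20) :
    ENNReal.ofReal ((1 / 2) ^ n) * ENNReal.ofReal ε ≤
      Measure.volumeIoiPow n (radialWindow ε) := by
  have h1 : (Measure.comap Subtype.val volume : Measure (Ioi (0 : ℝ))) (radialWindow ε)
      = ENNReal.ofReal ε := by
    rw [comap_subtype_coe_apply measurableSet_Ioi]
    have : (Subtype.val '' radialWindow ε : Set ℝ) = Ioo (1 - ε) 1 := by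
      ext r
      constructor
      · rintro ⟨s, hs, rfl⟩; exact hs
      · intro hr
        exact ⟨⟨r, by have := hr.1; simp only [mem_Ioi]; linarith⟩, hr, rfl⟩
    rw [this, Real.volume_Ioo, sub_sub_cancel]
  rw [Measure.volumeIoiPow, withDensity_apply _ (measurableSet_radialWindow ε), ← h1,
    ← setLIntegral_const]
  refine setLIntegral_mono' (measurableSet_radialWindow ε) fun r hr => ?_
  refine ENNReal.ofReal_le_ofReal (pow_le_pow_left₀ (by norm_num) ?_ _)
  linarith [hr.1]

lemma volumeIoiPow_radialWindow_ne_top (n : ℕ) (ε : ℝ) :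
    Measure.volumeIoiPow n (radialWindow ε) ≠ ∞ := by
  refine ((measure_mono (t := Iio ⟨1, mem_Ioi.2 one_pos⟩) fun r hr => ?_).trans_lt ?_).ne
  · exact hr.2
  · rw [Measure.volumeIoiPow_apply_Iio]; finiteness

/-- The extension of a density on the sphere to a thin shell inside the unit ball, normalized so
that its radial means are the original values. -/
def shellExtend {d : ℕ} (f : USphere d → ℂ) (ε : ℝ) (x : RSpace d) : ℂ :=
  {x : RSpace d | 1 - ε < ‖x‖ ∧ ‖x‖ < 1}.indicator
    (fun x => (((Measure.volumeIoiPow (d - 1)).real (radialWindow ε))⁻¹ : ℝ) *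
      Function.extend Subtype.val f 0 (‖x‖⁻¹ • x)) x

lemma shellExtend_smul {d : ℕ} (f : USphere d → ℂ) (ε : ℝ) (r : Ioi (0 : ℝ)) (ω : USphere d) :
    shellExtend f ε ((r : ℝ) • (ω : RSpace d)) = f ω *
      (radialWindow ε).indicator
        (fun _ => (((Measure.volumeIoiPow (d - 1)).real (radialWindow ε))⁻¹ : ℂ)) r := by
  have hr : (0 : ℝ) < r := r.2
  have e1 : ‖(r : ℝ) • (ω : RSpace d)‖ = r := by
    rw [norm_smul, norm_eq_of_mem_sphere ω, Real.norm_eq_abs, abs_of_pos hr, mul_one]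
  have e2 : Function.extend Subtype.val f 0 (ω : RSpace d) = f ω :=
    Subtype.val_injective.extend_apply _ _ _
  rw [shellExtend]
  by_cases h : r ∈ radialWindow ε
  · rw [indicator_of_mem h, indicator_of_mem (by rw [mem_ofPred_eq, e1]; exact h), e1, smul_smul,
      inv_mul_cancel₀ hr.ne', one_smul, e2]
    push_cast
    ring
  · rw [indicator_of_notMem h, indicator_of_notMem (by rw [mem_ofPred_eq, e1]; exact h), mul_zero]

lemma measurable_shellExtend {d : ℕ} {f : USphere d → ℂ} (hf : Measurable f) (ε : ℝ) :
    Measurable (shellExtend f ε) := by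
  have hemb : MeasurableEmbedding (Subtype.val : USphere d → RSpace d) :=
    MeasurableEmbedding.subtype_coe isClosed_sphere.measurableSet
  have h1 : Measurable (Function.extend Subtype.val f (0 : RSpace d → ℂ)) :=
    hemb.measurable_extend hf measurable_const
  refine Measurable.indicator (measurable_const.mul (h1.comp (by fun_prop))) ?_
  simp only [Set.ofPred_and]
  exact (measurableSet_lt (by fun_prop) (by fun_prop)).inter
    (measurableSet_lt (by fun_prop) (by fun_prop))

/-- With `ν(W)` the weighted length of the window, the squared norm of the extension is `‖f‖² ν(W)⁻²
ν(W)`, and `ν(W)` is at least a constant times `ε`. The factor `ε` on the left is the one gained in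
Schur's test; the bound no longer depends on it. -/
lemma lintegral_shellExtend_le {d : ℕ} (hd : 1 ≤ d) {f : USphere d → ℂ} (hf : Measurable f)
    {ε : ℝ} (hε : 0 < ε) (hε2 : ε ≤ 1 / 20) :
    ENNReal.ofReal ε * ∫⁻ x, ‖shellExtend f ε x‖ₑ ^ 2 ≤
      (ENNReal.ofReal ((1 / 2) ^ (d - 1)))⁻¹ * ∫⁻ ω, ‖f ω‖ₑ ^ 2 ∂(surfaceMeasure d) := by
  set ν := Measure.volumeIoiPow (d - 1)
  set W := radialWindow ε
  have hW := measurableSet_radialWindow ε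
  have hlow := volumeIoiPow_radialWindow_ge (d - 1) hε2
  have hWt : ν W ≠ ∞ := volumeIoiPow_radialWindow_ne_top _ _
  have hc0 : ENNReal.ofReal ((1 / 2) ^ (d - 1)) ≠ 0 := by
    rw [Ne, ENNReal.ofReal_eq_zero, not_le]; positivity
  have hε0 : ENNReal.ofReal ε ≠ 0 := by simpa using hε
  have hW0 : ν W ≠ 0 := fun h => by
    rw [h] at hlow
    exact mul_ne_zero hc0 hε0 (le_zero_iff.1 hlow)
  have e1 : ∫⁻ x, ‖shellExtend f ε x‖ₑ ^ 2 =
      (∫⁻ ω, ‖f ω‖ₑ ^ 2 ∂(surfaceMeasure d)) * (ν W)⁻¹ := by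
    rw [lintegral_eq_lintegral_prod hd ((measurable_shellExtend hf ε).enorm.pow_const 2)]
    have e2 : ∀ q : USphere d × Ioi (0 : ℝ),
        ‖shellExtend f ε ((q.2 : ℝ) • (q.1 : RSpace d))‖ₑ ^ 2 =
          ‖f q.1‖ₑ ^ 2 * W.indicator (fun _ => (ν W)⁻¹ ^ 2) q.2 := by
      intro q
      rw [shellExtend_smul, enorm_mul, mul_pow]
      congr 1
      by_cases hq : q.2 ∈ W
      · rw [indicator_of_mem hq, indicator_of_mem hq, ← Complex.ofReal_inv, ← ofReal_norm,
          Complex.norm_real, Real.norm_of_nonneg (by positivity), measureReal_def,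
          ← ENNReal.toReal_inv, ENNReal.ofReal_toReal (ENNReal.inv_ne_top.2 hW0)]
      · rw [indicator_of_notMem hq, indicator_of_notMem hq]; simp
    simp_rw [e2]
    rw [lintegral_prod_mul (hf.enorm.pow_const 2).aemeasurable
      (measurable_const.indicator hW).aemeasurable, lintegral_indicator_const hW]
    congr 1
    rw [sq, mul_assoc, ENNReal.inv_mul_cancel hW0 hWt, mul_one]
  rw [e1, ← mul_assoc, mul_right_comm]
  refine mul_le_mul_left ?_ _
  rw [← div_eq_mul_inv]
  refine ENNReal.div_le_of_le_mul ?_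
  calc ENNReal.ofReal ε = (ENNReal.ofReal ((1 / 2) ^ (d - 1)))⁻¹ *
        (ENNReal.ofReal ((1 / 2) ^ (d - 1)) * ENNReal.ofReal ε) := by
        rw [← mul_assoc, ENNReal.inv_mul_cancel hc0 ENNReal.ofReal_ne_top, one_mul]
    _ ≤ _ := mul_le_mul_right hlow _

/-- The wave integral of the extension to the shell is close to that of the density. -/
lemma norm_waveIntegral_shellExtend_sub_le {d : ℕ} (hd : 1 ≤ d) {f : USphere d → ℂ}
    (hf : Integrable f (surfaceMeasure d)) {ε : ℝ} (hε : 0 < ε) (hε2 : ε ≤ 1 / 20)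
    (x : RSpace d) :
    ‖waveIntegral (shellExtend f ε) x - sphereWave f x‖ ≤
      ε * (‖x‖ * ∫ ω, ‖f ω‖ ∂(surfaceMeasure d)) := by
  set ν := Measure.volumeIoiPow (d - 1) with hν
  set W := radialWindow ε
  have hW : MeasurableSet W := measurableSet_radialWindow ε
  have hlow := volumeIoiPow_radialWindow_ge (d - 1) hε2
  have hWt : ν W ≠ ∞ := volumeIoiPow_radialWindow_ne_top _ _
  have hW0 : ν W ≠ 0 := fun h => by
    rw [← hν, h] at hlow
    refine mul_ne_zero ?_ ?_ (le_zero_iff.1 hlow)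
    · rw [Ne, ENNReal.ofReal_eq_zero, not_le]; positivity
    · simpa using hε
  have hWr : ν.real W ≠ 0 := ENNReal.toReal_ne_zero.2 ⟨hW0, hWt⟩
  -- `w` is a probability density with respect to `ν`. Both wave integrals become integrals of `f
  -- w`, against plane waves at `r ω` and at `ω`, two points at distance at most `ε`.
  set w : Ioi (0 : ℝ) → ℂ := W.indicator fun _ => ((ν.real W)⁻¹ : ℂ) with hw
  have hwi : Integrable w ν := (integrable_indicator_iff hW).2 (integrableOn_const hWt)
  have hw1 : ∫ r, w r ∂ν = 1 := by
    rw [hw, integral_indicator_const _ hW, Complex.real_smul, mul_inv_cancel₀]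
    exact_mod_cast hWr
  have hwn : ∫ r, ‖w r‖ ∂ν = 1 := by
    have : ∀ r, ‖w r‖ = W.indicator (fun _ => (ν.real W)⁻¹) r := by
      intro r
      by_cases hr : r ∈ W
      · rw [hw, indicator_of_mem hr, indicator_of_mem hr, ← Complex.ofReal_inv, Complex.norm_real,
          Real.norm_of_nonneg (by positivity)]
      · rw [hw, indicator_of_notMem hr, indicator_of_notMem hr, norm_zero]
    simp_rw [this]
    rw [integral_indicator_const _ hW, smul_eq_mul, mul_inv_cancel₀ hWr]
  have hfw : Integrable (fun q : USphere d × Ioi (0 : ℝ) => f q.1 * w q.2)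
      ((surfaceMeasure d).prod ν) := hf.mul_prod hwi
  have e1 : waveIntegral (shellExtend f ε) x = ∫ q : USphere d × Ioi (0 : ℝ),
      f q.1 * w q.2 * planeWave x ((q.2 : ℝ) • (q.1 : RSpace d))
        ∂((surfaceMeasure d).prod ν) := by
    rw [waveIntegral, integral_eq_integral_prod hd]
    simp_rw [shellExtend_smul]
    rfl
  have e2 : sphereWave f x = ∫ q : USphere d × Ioi (0 : ℝ),
      f q.1 * w q.2 * planeWave x (q.1 : RSpace d) ∂((surfaceMeasure d).prod ν) := by
    have := integral_prod_mul (μ := surfaceMeasure d) (ν := ν)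
      (fun ω => f ω * planeWave x ω) w
    rw [hw1, mul_one] at this
    rw [sphereWave, ← this]
    refine integral_congr_ae (.of_forall fun q => ?_)
    simp only; ring
  have i1 : Integrable (fun q : USphere d × Ioi (0 : ℝ) =>
      f q.1 * w q.2 * planeWave x ((q.2 : ℝ) • (q.1 : RSpace d))) ((surfaceMeasure d).prod ν) :=
    hfw.mul_bdd (c := 1) ((continuous_planeWave_right x).comp
      (by fun_prop)).aestronglyMeasurable (.of_forall fun _ => (norm_planeWave _ _).le)
  have i2 : Integrable (fun q : USphere d × Ioi (0 : ℝ) =>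
      f q.1 * w q.2 * planeWave x (q.1 : RSpace d)) ((surfaceMeasure d).prod ν) :=
    hfw.mul_bdd (c := 1) ((continuous_planeWave_right x).comp
      (by fun_prop)).aestronglyMeasurable (.of_forall fun _ => (norm_planeWave _ _).le)
  rw [e1, e2, ← integral_sub i1 i2]
  have hbound : ∀ q : USphere d × Ioi (0 : ℝ),
      ‖f q.1 * w q.2 * planeWave x ((q.2 : ℝ) • (q.1 : RSpace d)) -
        f q.1 * w q.2 * planeWave x (q.1 : RSpace d)‖ ≤ (ε * ‖x‖) * (‖f q.1‖ * ‖w q.2‖) := by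
    intro q
    rw [← mul_sub, norm_mul, norm_mul, mul_comm]
    by_cases hq : q.2 ∈ W
    · refine mul_le_mul_of_nonneg_right ((norm_planeWave_sub_le _ _ _).trans ?_) (by positivity)
      have e3 : (q.2 : ℝ) • (q.1 : RSpace d) - (q.1 : RSpace d)
          = ((q.2 : ℝ) - 1) • (q.1 : RSpace d) := by module
      have e4 : |(q.2 : ℝ) - 1| ≤ ε := by
        rw [abs_le]; constructor <;> linarith [hq.1, hq.2]
      rw [e3, norm_smul, norm_eq_of_mem_sphere q.1, mul_one, Real.norm_eq_abs, mul_comm]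
      gcongr
    · have : w q.2 = 0 := indicator_of_notMem hq _
      simp [this]
  refine (norm_integral_le_of_norm_le ((hf.norm.mul_prod hwi.norm).const_mul _)
    (.of_forall hbound)).trans_eq ?_
  rw [integral_const_mul, integral_prod_mul (fun ω => ‖f ω‖) (fun r => ‖w r‖), hwn]
  ring

/-! ### Caps of the sphere and their finite unions -/

/-- The weighted estimate for densities supported in a small cap of the sphere. -/
lemma IsAdmissibleRadialGauge.exists_lintegral_sphereWave_cap_le {d : ℕ} {φ : ℝ → ℝ}
    (hφ : IsAdmissibleRadialGauge d φ) (hd : 2 ≤ d) :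
    ∃ C : ℝ≥0∞, C ≠ ∞ ∧ ∀ (p : RSpace d) (f : USphere d → ℂ), Measurable f →
      MemLp f 2 (surfaceMeasure d) → (∀ ω : USphere d, 1 / 8 ≤ dist (ω : RSpace d) p → f ω = 0) →
      ∫⁻ x, ENNReal.ofReal (φ ‖x‖) * ‖sphereWave f x‖ₑ ^ 2 ≤
        C * ∫⁻ ω, ‖f ω‖ₑ ^ 2 ∂(surfaceMeasure d) := by
  obtain ⟨C, hC, hC'⟩ := hφ.exists_lintegral_waveIntegral_le hd
  refine ⟨C * (ENNReal.ofReal ((1 / 2) ^ (d - 1)))⁻¹, ?_, fun p f hfm hf hf0 => ?_⟩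
  · refine ENNReal.mul_ne_top hC (ENNReal.inv_ne_top.2 ?_)
    rw [Ne, ENNReal.ofReal_eq_zero, not_le]; positivity
  have hfi : Integrable f (surfaceMeasure d) := hf.integrable (by norm_num)
  set ε : ℕ → ℝ := fun n => 1 / 20 * (1 / ((n : ℝ) + 1)) with hεdef
  have hε : ∀ n, 0 < ε n := fun n => by positivity
  have hε2 : ∀ n, ε n ≤ 1 / 20 := fun n => by
    refine mul_le_of_le_one_right (by norm_num) ?_
    rw [div_le_one (by positivity)]
    linarith [(Nat.cast_nonneg n : (0 : ℝ) ≤ n)]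
  have hεlim : Tendsto ε atTop (𝓝 0) := by
    have := (tendsto_one_div_add_atTop_nhds_zero_nat (𝕜 := ℝ)).const_mul (1 / 20 : ℝ)
    rwa [mul_zero] at this
  have hfin : ∫⁻ ω, ‖f ω‖ₑ ^ 2 ∂(surfaceMeasure d) ≠ ∞ := by
    rw [lintegral_enorm_sq_eq]
    exact ENNReal.pow_ne_top hf.2.ne
  have hF2 : ∀ n, MemLp (shellExtend f (ε n)) 2 := by
    intro n
    refine ⟨(measurable_shellExtend hfm _).aestronglyMeasurable, ?_⟩
    have h1 := (lintegral_shellExtend_le (by omega) hfm (hε n) (hε2 n)).trans_lt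
      (ENNReal.mul_lt_top (lt_top_iff_ne_top.2 (ENNReal.inv_ne_top.2 (by
        rw [Ne, ENNReal.ofReal_eq_zero, not_le]; positivity))) (lt_top_iff_ne_top.2 hfin))
    rw [lintegral_enorm_sq_eq] at h1
    have h2 := ENNReal.lt_top_of_mul_ne_top_right h1.ne (by simpa using hε n)
    by_contra hc
    rw [not_lt, top_le_iff] at hc
    simp [hc] at h2
  -- The radius leaves room on both sides: `1 / 8 + 1 / 20 ≤ 3 / 16 < 1 / 4`. Together with `ε n < 2
  -- * ε n` this places a closed set inside the open cap.
  set K : ℕ → Set (RSpace d) := fun n => {x | |‖x‖ - 1| ≤ ε n ∧ dist x p ≤ 3 / 16}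
  have hK : ∀ n, IsClosed (K n) := fun n => by
    simp only [K, Set.ofPred_and]
    exact (isClosed_le (by fun_prop) (by fun_prop)).inter (isClosed_le (by fun_prop) (by fun_prop))
  have hKU : ∀ n, K n ⊆ shellCap p (ε n) := fun n x hx =>
    ⟨by linarith [hx.1, hε n], by linarith [hx.2]⟩
  have hF0 : ∀ n, ∀ x ∉ K n, shellExtend f (ε n) x = 0 := by
    intro n x hx
    by_contra hne
    refine hx ?_
    have hmem : 1 - ε n < ‖x‖ ∧ ‖x‖ < 1 := by
      by_contra h
      exact hne (indicator_of_notMem (s := {x : RSpace d | 1 - ε n < ‖x‖ ∧ ‖x‖ < 1}) h _)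
    have hx0 : 0 < ‖x‖ := by linarith [hε2 n, hmem.1]
    set ω : USphere d := ⟨‖x‖⁻¹ • x, by
      rw [mem_sphere_zero_iff_norm, norm_smul, norm_inv, norm_norm, inv_mul_cancel₀ hx0.ne']⟩
    have hxω : x = ‖x‖ • (ω : RSpace d) := by
      simp only [ω, smul_smul, mul_inv_cancel₀ hx0.ne', one_smul]
    have hfω : f ω ≠ 0 := by
      intro h0
      have := shellExtend_smul f (ε n) ⟨‖x‖, hx0⟩ ω
      rw [h0, zero_mul] at this
      exact hne (by rw [hxω]; exact this)
    have h1 : dist (ω : RSpace d) p < 1 / 8 := by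
      by_contra! h; exact hfω (hf0 ω h)
    have h2 : dist x (ω : RSpace d) ≤ 1 / 20 := by
      have : x - (ω : RSpace d) = (‖x‖ - 1) • (ω : RSpace d) := by
        rw [sub_smul, one_smul, ← hxω]
      rw [dist_eq_norm, this, norm_smul, norm_eq_of_mem_sphere ω, mul_one, Real.norm_eq_abs,
        abs_le]
      constructor <;> linarith [hmem.1, hmem.2, hε2 n]
    refine ⟨abs_le.2 ⟨by linarith [hmem.1], by linarith [hmem.2, hε n]⟩, ?_⟩
    linarith [dist_triangle x (ω : RSpace d) p]
  have hFi : ∀ n, Integrable (shellExtend f (ε n)) := by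
    intro n
    have hs : Function.support (shellExtend f (ε n)) ⊆ closedBall p (3 / 16) := fun x hx => by
      by_contra h
      exact hx (hF0 n x fun hxK => h hxK.2)
    rw [← integrableOn_iff_integrable_of_support_subset hs]
    have : IsFiniteMeasure (volume.restrict (closedBall p (3 / 16))) :=
      ⟨by rw [Measure.restrict_apply_univ]; exact measure_closedBall_lt_top⟩
    exact ((hF2 n).restrict _).integrable (by norm_num)
  refine hφ.lintegral_le_of_tendsto (f := fun n => waveIntegral (shellExtend f (ε n)))
    (b := fun _ => C * (ENNReal.ofReal ((1 / 2) ^ (d - 1)))⁻¹ *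
      ∫⁻ ω, ‖f ω‖ₑ ^ 2 ∂(surfaceMeasure d))
    (fun n => continuous_waveIntegral (hFi n)) (fun x => ?_) (fun n => ?_) tendsto_const_nhds
  · rw [tendsto_iff_norm_sub_tendsto_zero]
    refine squeeze_zero (fun n => norm_nonneg _)
      (fun n => norm_waveIntegral_shellExtend_sub_le (by omega) hfi (hε n) (hε2 n) x) ?_
    simpa using hεlim.mul_const (‖x‖ * ∫ ω, ‖f ω‖ ∂(surfaceMeasure d))
  · refine (hC' p (ε n) (hε n) (hε2 n) _ (K n) (hF2 n) (hK n) (hKU n) (hF0 n)).trans ?_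
    rw [mul_assoc, mul_assoc]
    exact mul_le_mul_right (lintegral_shellExtend_le (by omega) hfm (hε n) (hε2 n)) _

/-- The weighted estimate for densities supported in a finite union of small caps. -/
lemma IsAdmissibleRadialGauge.exists_lintegral_sphereWave_finset_le {d : ℕ} {φ : ℝ → ℝ}
    (hφ : IsAdmissibleRadialGauge d φ) (hd : 2 ≤ d) (t : Finset (RSpace d)) :
    ∃ C : ℝ≥0∞, C ≠ ∞ ∧ ∀ f : USphere d → ℂ, Measurable f →
      MemLp f 2 (surfaceMeasure d) →
      (∀ ω : USphere d, (∀ p ∈ t, 1 / 8 ≤ dist (ω : RSpace d) p) → f ω = 0) →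
      ∫⁻ x, ENNReal.ofReal (φ ‖x‖) * ‖sphereWave f x‖ₑ ^ 2 ≤
        C * ∫⁻ ω, ‖f ω‖ₑ ^ 2 ∂(surfaceMeasure d) := by
  classical
  induction t using Finset.induction_on with
  | empty =>
    refine ⟨0, by simp, fun f _ _ hf0 => ?_⟩
    have : f = 0 := funext fun ω => hf0 ω (by simp)
    simp [this, sphereWave]
  | insert p t _ ih =>
    obtain ⟨C, hC, hC'⟩ := ih
    obtain ⟨D, hD, hD'⟩ := hφ.exists_lintegral_sphereWave_cap_le hd
    -- The `3` comes from `(x + y)² ≤ 3 x² + 3 y²`, for the parts of `f` inside and outside the cap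
    -- at `p`.
    refine ⟨3 * (D + C), by finiteness, fun f hfm hf hf0 => ?_⟩
    set A : Set (USphere d) := {ω | dist (ω : RSpace d) p < 1 / 8}
    have hA : MeasurableSet A := measurableSet_lt (by fun_prop) (by fun_prop)
    have b1 := hD' p (A.indicator f) (hfm.indicator hA) (hf.indicator hA)
      fun ω hω => indicator_of_notMem (s := A) (not_lt.2 hω) _
    have b2 := hC' (Aᶜ.indicator f) (hfm.indicator hA.compl) (hf.indicator hA.compl)
      fun ω hω => by
        by_cases h : ω ∈ A
        · exact indicator_of_notMem (notMem_compl_iff.2 h) _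
        · rw [indicator_of_mem (show ω ∈ Aᶜ from h)]
          refine hf0 ω fun q hq => ?_
          rcases Finset.mem_insert.1 hq with rfl | hq
          · exact not_lt.1 h
          · exact hω q hq
    have i1 := (hf.indicator hA).integrable (by norm_num)
    have i2 := (hf.indicator hA.compl).integrable (by norm_num)
    have hsum : ∀ x, sphereWave f x =
        sphereWave (A.indicator f) x + sphereWave (Aᶜ.indicator f) x := by
      intro x
      rw [sphereWave, sphereWave, sphereWave,
        ← integral_add (integrable_sphereWave i1 x) (integrable_sphereWave i2 x)]
      refine integral_congr_ae (.of_forall fun ω => ?_)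
      simp only
      rw [← add_mul, ← Pi.add_apply, indicator_self_add_compl]
    have hle : ∀ B : Set (USphere d), ∫⁻ ω, ‖B.indicator f ω‖ₑ ^ 2 ∂(surfaceMeasure d) ≤
        ∫⁻ ω, ‖f ω‖ₑ ^ 2 ∂(surfaceMeasure d) := fun B => lintegral_mono fun ω => by
      gcongr
      exact enorm_indicator_le_enorm_self _ _
    have hm1 : AEMeasurable fun x : RSpace d => 3 * (ENNReal.ofReal (φ ‖x‖) *
        ‖sphereWave (A.indicator f) x‖ₑ ^ 2) :=
      (hφ.aemeasurable.mul ((continuous_sphereWave i1).measurable.enorm.pow_const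
        2).aemeasurable).const_mul _
    calc ∫⁻ x, ENNReal.ofReal (φ ‖x‖) * ‖sphereWave f x‖ₑ ^ 2
        ≤ ∫⁻ x, (3 * (ENNReal.ofReal (φ ‖x‖) * ‖sphereWave (A.indicator f) x‖ₑ ^ 2) +
            3 * (ENNReal.ofReal (φ ‖x‖) * ‖sphereWave (Aᶜ.indicator f) x‖ₑ ^ 2)) := by
          refine lintegral_mono fun x => ?_
          rw [hsum x, mul_left_comm 3, mul_left_comm 3, ← mul_add, ← mul_add]
          refine mul_le_mul_right ((pow_le_pow_left' (enorm_add_le _ _) 2).trans ?_) _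
          have := ENNReal.mul_le_sq_add_sq ‖sphereWave (A.indicator f) x‖ₑ
            ‖sphereWave (Aᶜ.indicator f) x‖ₑ
          calc _ = ‖sphereWave (A.indicator f) x‖ₑ ^ 2 + ‖sphereWave (Aᶜ.indicator f) x‖ₑ ^ 2 +
                2 * (‖sphereWave (A.indicator f) x‖ₑ * ‖sphereWave (Aᶜ.indicator f) x‖ₑ) := by ring
            _ ≤ ‖sphereWave (A.indicator f) x‖ₑ ^ 2 + ‖sphereWave (Aᶜ.indicator f) x‖ₑ ^ 2 +
                2 * (‖sphereWave (A.indicator f) x‖ₑ ^ 2 +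
                  ‖sphereWave (Aᶜ.indicator f) x‖ₑ ^ 2) := by gcongr
            _ = _ := by ring
      _ = 3 * (∫⁻ x, ENNReal.ofReal (φ ‖x‖) * ‖sphereWave (A.indicator f) x‖ₑ ^ 2) +
            3 * ∫⁻ x, ENNReal.ofReal (φ ‖x‖) * ‖sphereWave (Aᶜ.indicator f) x‖ₑ ^ 2 := by
          rw [lintegral_add_left' hm1, lintegral_const_mul' _ _ (by norm_num),
            lintegral_const_mul' _ _ (by norm_num)]
      _ ≤ 3 * (D * ∫⁻ ω, ‖f ω‖ₑ ^ 2 ∂(surfaceMeasure d)) +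
            3 * (C * ∫⁻ ω, ‖f ω‖ₑ ^ 2 ∂(surfaceMeasure d)) := by
          gcongr
          · exact b1.trans (mul_le_mul_right (hle _) _)
          · exact b2.trans (mul_le_mul_right (hle _) _)
      _ = _ := by ring

/-! ### Carleson estimates on the Herglotz space -/

namespace Herglotz

variable {d : ℕ}

lemma apply_eq (u : Herglotz d) (x : RSpace d) :
    u x = (cNorm d : ℂ) * sphereWave (density d u) x := by
  rw [coe_eq, herglotzOp_apply]; rfl

lemma enorm_eq (u : Herglotz d) : ‖u‖ₑ = eLpNorm (density d u) 2 (surfaceMeasure d) := by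
  rw [← ofReal_norm, norm_def, Lp.norm_def, ENNReal.ofReal_toReal (Lp.eLpNorm_ne_top _)]

lemma continuous_coe (u : Herglotz d) : Continuous u := by
  have : ⇑u = fun x => (cNorm d : ℂ) * sphereWave (density d u) x := funext (apply_eq u)
  rw [this]
  exact continuous_const.mul (continuous_sphereWave (integrable_sphereL2 _))

/-- Point evaluations are bounded uniformly in the point. -/
lemma exists_enorm_apply_le (d : ℕ) :
    ∃ B : ℝ≥0∞, B ≠ ∞ ∧ ∀ (u : Herglotz d) (x : RSpace d), ‖u x‖ₑ ≤ B * ‖u‖ₑ := by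
  refine ⟨‖(cNorm d : ℂ)‖ₑ * surfaceMeasure d univ ^ (1 / 2 : ℝ), ?_, fun u x => ?_⟩
  · exact ENNReal.mul_ne_top (by finiteness)
      (ENNReal.rpow_ne_top_of_nonneg (by norm_num) (measure_ne_top _ _))
  · have h1 : ‖sphereWave (density d u) x‖ₑ ≤ eLpNorm (density d u) 1 (surfaceMeasure d) := by
      rw [eLpNorm_one_eq_lintegral_enorm]
      refine (enorm_integral_le_lintegral_enorm _).trans_eq (lintegral_congr fun ω => ?_)
      rw [enorm_mul, ← ofReal_norm (planeWave x ω), norm_planeWave, ENNReal.ofReal_one, mul_one]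
    have h2 := eLpNorm_le_eLpNorm_mul_rpow_measure_univ (p := 1) (q := 2) (by norm_num)
      (Lp.aestronglyMeasurable (density d u))
    rw [apply_eq, enorm_mul, enorm_eq, mul_assoc]
    refine mul_le_mul_right (h1.trans (h2.trans_eq ?_)) _
    rw [mul_comm]
    norm_num

end Herglotz

/-- The weighted estimate on the Herglotz space. -/
lemma IsAdmissibleRadialGauge.exists_lintegral_herglotz_le {d : ℕ} {φ : ℝ → ℝ}
    (hφ : IsAdmissibleRadialGauge d φ) (hd : 2 ≤ d) :
    ∃ C : ℝ≥0∞, C ≠ ∞ ∧ ∀ u : Herglotz d,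
      ∫⁻ x, ENNReal.ofReal (φ ‖x‖) * ‖u x‖ₑ ^ 2 ≤ C * ‖u‖ₑ ^ 2 := by
  obtain ⟨t, -, ht, hcov⟩ := (isCompact_sphere (0 : RSpace d) 1).finite_cover_balls
    (by norm_num : (0 : ℝ) < 1 / 8)
  obtain ⟨C, hC, hC'⟩ := hφ.exists_lintegral_sphereWave_finset_le hd ht.toFinset
  refine ⟨‖(cNorm d : ℂ)‖ₑ ^ 2 * C, by finiteness, fun u => ?_⟩
  have h1 := hC' (Herglotz.density d u) (Lp.stronglyMeasurable _).measurable (Lp.memLp _)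
    fun ω hω => by
      obtain ⟨p, hp, hpω⟩ := mem_iUnion₂.1 (hcov ω.2)
      exact absurd hpω (not_lt.2 (hω p (ht.mem_toFinset.2 hp)))
  rw [lintegral_enorm_sq_eq, ← Herglotz.enorm_eq] at h1
  calc _ = ∫⁻ x, ‖(cNorm d : ℂ)‖ₑ ^ 2 *
        (ENNReal.ofReal (φ ‖x‖) * ‖sphereWave (Herglotz.density d u) x‖ₑ ^ 2) := by
        refine lintegral_congr fun x => ?_
        rw [Herglotz.apply_eq, enorm_mul]; ring
    _ = ‖(cNorm d : ℂ)‖ₑ ^ 2 *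
        ∫⁻ x, ENNReal.ofReal (φ ‖x‖) * ‖sphereWave (Herglotz.density d u) x‖ₑ ^ 2 :=
        lintegral_const_mul' _ _ (by finiteness)
    _ ≤ ‖(cNorm d : ℂ)‖ₑ ^ 2 * (C * ‖u‖ₑ ^ 2) := mul_le_mul_right h1 _
    _ = _ := (mul_assoc _ _ _).symm

/-- The measure with density `|a|` is a Carleson measure for the Herglotz space. -/
lemma IsAdmissibleRadialGauge.exists_lintegral_symbol_le {d : ℕ} {φ : ℝ → ℝ}
    (hφ : IsAdmissibleRadialGauge d φ) (hd : 2 ≤ d) {a : RSpace d → ℂ}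
    (ha : LocallyIntegrable a) {C R : ℝ}
    (hdom : ∀ᵐ x : RSpace d, R ≤ ‖x‖ → ‖a x‖ ≤ C * φ ‖x‖) :
    ∃ D : ℝ≥0∞, D ≠ ∞ ∧ ∀ u : Herglotz d, ∫⁻ x, ‖a x‖ₑ * ‖u x‖ₑ ^ 2 ≤ D * ‖u‖ₑ ^ 2 := by
  obtain ⟨K, hK, hK'⟩ := hφ.exists_lintegral_herglotz_le hd
  obtain ⟨B, hB, hB'⟩ := Herglotz.exists_enorm_apply_le d
  set A := ∫⁻ x in closedBall (0 : RSpace d) R, ‖a x‖ₑ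
  have hA : A ≠ ∞ := (ha.integrableOn_isCompact (isCompact_closedBall _ _)).2.ne
  -- The first summand is the cost of the ball of radius `R`, where only the uniform bound on point
  -- evaluations is used. No sign is assumed for `C`, hence `|C|`.
  refine ⟨A * B ^ 2 + ENNReal.ofReal |C| * K, by finiteness, fun u => ?_⟩
  have hpt : ∀ᵐ x : RSpace d, ‖a x‖ₑ * ‖u x‖ₑ ^ 2 ≤
      (closedBall (0 : RSpace d) R).indicator (fun x => ‖a x‖ₑ * (B * ‖u‖ₑ) ^ 2) x +
        ENNReal.ofReal |C| * (ENNReal.ofReal (φ ‖x‖) * ‖u x‖ₑ ^ 2) := by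
    filter_upwards [hdom, hφ.ae_nonneg hd] with x hx hx0
    by_cases hxR : x ∈ closedBall (0 : RSpace d) R
    · rw [indicator_of_mem hxR]
      refine le_trans ?_ le_self_add
      gcongr
      exact hB' u x
    · refine le_trans ?_ le_add_self
      rw [mem_closedBall_zero_iff, not_le] at hxR
      rw [← mul_assoc, ← ENNReal.ofReal_mul (abs_nonneg C), ← ofReal_norm (a x)]
      gcongr
      exact (hx hxR.le).trans (mul_le_mul_of_nonneg_right (le_abs_self C) hx0)
  have hm : AEMeasurable fun x : RSpace d =>
      (closedBall (0 : RSpace d) R).indicator (fun x => ‖a x‖ₑ * (B * ‖u‖ₑ) ^ 2) x :=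
    (ha.aestronglyMeasurable.enorm.mul_const _).indicator measurableSet_closedBall
  calc _ ≤ _ := lintegral_mono_ae hpt
    _ = A * (B * ‖u‖ₑ) ^ 2 +
        ENNReal.ofReal |C| * ∫⁻ x, ENNReal.ofReal (φ ‖x‖) * ‖u x‖ₑ ^ 2 := by
        rw [lintegral_add_left' hm, lintegral_indicator measurableSet_closedBall,
          lintegral_mul_const' _ _ (by finiteness), lintegral_const_mul' _ _ (by finiteness)]
    _ ≤ A * (B * ‖u‖ₑ) ^ 2 + ENNReal.ofReal |C| * (K * ‖u‖ₑ ^ 2) := by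
        gcongr
        exact hK' u
    _ = _ := by ring

/-! ### The bounded form and its operator -/

/-- A sesquilinear form which is bounded by the sum of the squares of the norms is bounded. -/
lemma LinearMap.norm_le_mul_of_norm_le_sq_add_sq {E : Type*} [NormedAddCommGroup E]
    [NormedSpace ℂ E] (L : E →ₗ⋆[ℂ] E →ₗ[ℂ] ℂ) {K : ℝ}
    (h : ∀ v u, ‖L v u‖ ≤ K * (‖u‖ ^ 2 + ‖v‖ ^ 2)) (v u : E) :
    ‖L v u‖ ≤ 2 * K * ‖v‖ * ‖u‖ := by
  rcases eq_or_ne u 0 with rfl | hu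
  · simp
  rcases eq_or_ne v 0 with rfl | hv
  · simp
  have hu' : 0 < ‖u‖ := norm_pos_iff.2 hu
  have hv' : 0 < ‖v‖ := norm_pos_iff.2 hv
  -- Homogeneity: on unit vectors the hypothesis reads `K * (1 + 1)`, which is the factor `2 * K`.
  have h1 := h (((‖v‖⁻¹ : ℝ) : ℂ) • v) (((‖u‖⁻¹ : ℝ) : ℂ) • u)
  simp only [map_smulₛₗ, LinearMap.smul_apply, norm_smul, Complex.norm_real,
    RCLike.norm_conj, norm_inv, norm_norm, inv_mul_cancel₀ hu'.ne', inv_mul_cancel₀ hv'.ne'] at h1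
  have h2 : ‖L v u‖ = ‖v‖ * ‖u‖ * (‖v‖⁻¹ * (‖u‖⁻¹ * ‖L v u‖)) := by field_simp
  rw [h2]
  calc _ ≤ ‖v‖ * ‖u‖ * (K * (1 ^ 2 + 1 ^ 2)) := by
        refine mul_le_mul_of_nonneg_left ?_ (by positivity)
        simpa [mul_left_comm] using h1
    _ = _ := by ring

end

theorem theorem8p5 (d : ℕ) (hd : 2 ≤ d) (φ : ℝ → ℝ) (hφ : IsAdmissibleRadialGauge d φ)
    (a : RSpace d → ℂ) (ha : LocallyIntegrable a) (C R : ℝ)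
    (hdom : ∀ᵐ x : RSpace d, R ≤ ‖x‖ → ‖a x‖ ≤ C * φ ‖x‖) :
    IsBoundedSymbolForm a ∧
      ∃ T : Herglotz d →L[ℂ] Herglotz d, IsToeplitzOperator a T ∧
        ∀ u v : Herglotz d, inner ℂ v (T u) = symbolForm a u v := by
  obtain ⟨D, hD, hD'⟩ := hφ.exists_lintegral_symbol_le hd ha hdom
  have hm : ∀ u v : Herglotz d, AEStronglyMeasurable (fun x => a x * u x * conj (v x)) volume :=
    fun u v => (ha.aestronglyMeasurable.mul u.continuous_coe.aestronglyMeasurable).mul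
      (Complex.continuous_conj.comp v.continuous_coe).aestronglyMeasurable
  -- Bounding `|u v|` by `|u|² + |v|²` replaces the Cauchy–Schwarz inequality; rescaling restores
  -- the product of norms in `hLb`.
  have hle : ∀ u v : Herglotz d, ∫⁻ x, ‖a x * u x * conj (v x)‖ₑ ≤
      D * (‖u‖ₑ ^ 2 + ‖v‖ₑ ^ 2) := by
    intro u v
    calc _ ≤ ∫⁻ x, (‖a x‖ₑ * ‖u x‖ₑ ^ 2 + ‖a x‖ₑ * ‖v x‖ₑ ^ 2) := by
          refine lintegral_mono fun x => ?_
          have : ‖conj (v x)‖ₑ = ‖v x‖ₑ := by rw [← ofReal_norm, RCLike.norm_conj, ofReal_norm]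
          rw [enorm_mul, enorm_mul, this, mul_assoc, ← mul_add]
          exact mul_le_mul_right (ENNReal.mul_le_sq_add_sq _ _) _
      _ = (∫⁻ x, ‖a x‖ₑ * ‖u x‖ₑ ^ 2) + ∫⁻ x, ‖a x‖ₑ * ‖v x‖ₑ ^ 2 :=
          lintegral_add_left' (ha.aestronglyMeasurable.enorm.mul
            (u.continuous_coe.measurable.enorm.pow_const 2).aemeasurable) _
      _ ≤ _ := by rw [mul_add]; exact add_le_add (hD' u) (hD' v)
  have hint : ∀ u v : Herglotz d, Integrable (fun x => a x * u x * conj (v x)) := fun u v =>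
    ⟨hm u v, (hle u v).trans_lt (by finiteness)⟩
  let L : Herglotz d →ₗ⋆[ℂ] Herglotz d →ₗ[ℂ] ℂ :=
    LinearMap.mk₂'ₛₗ (starRingEnd ℂ) (RingHom.id ℂ) (fun v u => symbolForm a u v)
      (fun v w u => by
        simp only [symbolForm]
        rw [← integral_add (hint u v) (hint u w)]
        refine integral_congr_ae (.of_forall fun x => ?_)
        simp only [RKHS.coe_add, Pi.add_apply, map_add]; ring)
      (fun c v u => by
        simp only [symbolForm, smul_eq_mul]
        rw [← integral_const_mul]
        refine integral_congr_ae (.of_forall fun x => ?_)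
        simp only [RKHS.coe_smul, Pi.smul_apply, smul_eq_mul, map_mul]; ring)
      (fun v u w => by
        simp only [symbolForm]
        rw [← integral_add (hint u v) (hint w v)]
        refine integral_congr_ae (.of_forall fun x => ?_)
        simp only [RKHS.coe_add, Pi.add_apply]; ring)
      (fun c v u => by
        simp only [symbolForm, RingHom.id_apply, smul_eq_mul]
        rw [← integral_const_mul]
        refine integral_congr_ae (.of_forall fun x => ?_)
        simp only [RKHS.coe_smul, Pi.smul_apply, smul_eq_mul]; ring)
  have hL : ∀ v u, L v u = symbolForm a u v := fun _ _ => rfl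
  have hLb : ∀ v u, ‖L v u‖ ≤ 2 * D.toReal * ‖v‖ * ‖u‖ := by
    refine L.norm_le_mul_of_norm_le_sq_add_sq fun v u => ?_
    have h1 : ‖L v u‖ₑ ≤ D * (‖u‖ₑ ^ 2 + ‖v‖ₑ ^ 2) :=
      (enorm_integral_le_lintegral_enorm _).trans (hle u v)
    have h2 := ENNReal.toReal_mono (by finiteness) h1
    rw [ENNReal.toReal_mul, ENNReal.toReal_add (by finiteness) (by finiteness)] at h2
    simpa using h2
  refine ⟨⟨hint, 2 * D.toReal, fun u v => ?_⟩, ?_⟩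
  · rw [mul_right_comm]
    exact hLb v u
  -- Riesz gives an operator `S` with `inner (S v) u = L v u`; its adjoint therefore satisfies
  -- `inner v (T u) = F_a(u, v)`. The inner product is conjugate-linear in its first slot, so this
  -- is `⟨T u, v⟩` in the convention of the theorem.
  · let T := (InnerProductSpace.continuousLinearMapOfBilin
      (L.mkContinuous₂ (2 * D.toReal) hLb)).adjoint
    have hT : ∀ u v : Herglotz d, inner ℂ v (T u) = symbolForm a u v := by
      intro u v
      rw [ContinuousLinearMap.adjoint_inner_right,
        InnerProductSpace.continuousLinearMapOfBilin_apply]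
      exact hL v u
    refine ⟨T, fun u x => ?_, hT⟩
    -- The pointwise formula is the weak one at `v = κ_x`, by the reproducing property.
    rw [← hT, Herglotz.reproducingKernel, RKHS.kerFun_inner]
    simp
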